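/- All registers are finite-dimensional complex Hilbert spaces, logarithms have base $2$, $H(\rho)=-\mathrm{Tr}(\rho\log\rho)$, $H(X|Y)=H(XY)-H(Y)$, $I(X;Y|Z)=H(X|Z)-H(X|YZ)$, and $\|D\|=\mathrm{Tr}|D|$. **Protocols.** Let $M\ge 2$ be even. An $M$-message protocol $\Pi$ with input registers $A_{in},B_{in}$ and output registers $A_{out},B_{out}$ consists of a pure state $\psi$ on $T_A\otimes T_B$, memory registers $A_1,A_3,\dots,A_{M-1},A'$ (Alice) and $B_2,B_4,\dots,B_{M-2},B'$ (Bob), message registers $C_1,\dots,C_M$ (all of these arbitrary), and unitaries $$U_1:A_{in}\otimes T_A\to A_1\otimes C_1,\quad U_i:B_{i-2}\otimes C_{i-1}\to B_i\otimes C_i\ (i\text{ even}),\quad U_i:A_{i-2}\otimes C_{i-1}\to A_i\otimes C_i\ (i\ge 3\text{ odd}),$$ where $B_0=B_{in}\otimes T_B$, $B_M=B_{out}\otimes B'$, $A_{M+1}=A_{out}\otimes A'$ and $C_{M+1}$ is trivial. It implements the channel $\Pi(\rho)=\mathrm{Tr}_{A'B'}\big(U_{M+1}\cdots U_1(\rho\otimes\psi)\big)$.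 For an input state $\rho$ with purification $\rho^{A_{in}B_{in}R}$, its quantum information cost is $$QIC(\Pi,\rho)=\sum_{i\text{ odd}}\tfrac12 I(C_i;R|B_{i-1})+\sum_{i\text{ even}}\tfrac12 I(C_i;R|A_{i-1}),\qquad 1\le i\le M,$$ the $i$-th term being evaluated in the joint state right after $U_i$; it does not depend on the purification. **Tasks.** A quantum task $(\mathcal N,\rho,\epsilon)$ consists of a channel $\mathcal N$ from $A_{in}\otimes B_{in}$ to $A_{out}\otimes B_{out}$, a state $\rho$ on $A_{in}\otimes B_{in}$ and $\epsilon\in[0,2]$. A product quantum task is a finite non-empty tensor product $T=\bigotimes_{i}(\mathcal N_i,\rho_i,\epsilon_i)$ of quantum tasks; if $T_1,T_2$ are product quantum tasks, so is $T_1\otimes T_2$. In a protocol for $T$, Alice has the input registers $A_{in}^i$ and the output registers $A_{out}^i$ of all components, and Bob has all the $B_{in}^i$ and $B_{out}^i$. Let $R^i$ purify $\rho_i$. The protocol $\Pi$ succeeds at $T$ if for each $i$ $$\big\|\mathrm{Tr}_{\neg(A_{out}^iB_{out}^iR^i)}\,\Pi\big(\textstyle\bigotimes_j\rho_j^{A_{in}^jB_{in}^jR^j}\big)-\mathcal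 N_i\big(\rho_i^{A_{in}^iB_{in}^iR^i}\big)\big\|\le\epsilon_i ,$$ where channels act as the identity on the reference registers. Let $QIC_\otimes(T)$ be the infimum of $QIC(\Pi,\bigotimes_i\rho_i)$ over all protocols $\Pi$ that succeed at $T$, with any number of messages, and let $QIC^M_\otimes(T)$ be the infimum over those with $M$ messages (with $\inf\emptyset=+\infty$). For a single task write $QIC(\mathcal N,\rho,\epsilon)$ and $QIC^M(\mathcal N,\rho,\epsilon)$, and put $QIC_n(\mathcal N^{\otimes n},\rho^{\otimes n},\epsilon)=QIC_\otimes((\mathcal N,\rho,\epsilon)^{\otimes n})$ and $QIC_n^M(\mathcal N^{\otimes n},\rho^{\otimes n},\epsilon)=QIC^M_\otimes((\mathcal N,\rho,\epsilon)^{\otimes n})$. **Theorem (additivity).** (1) For any two product quantum tasks $T_1,T_2$ and every number $M$ of messages, $$QIC_\otimes(T_1\otimes T_2)=QIC_\otimes(T_1)+QIC_\otimes(T_2),\qquad QIC^M_\otimes(T_1\otimes T_2)=QIC^M_\otimes(T_1)+QIC^M_\otimes(T_2).$$ (2) For every quantum task $(\mathcal N,\rho,\epsilon)$, every integer $n\ge1$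 and every number $M$ of messages, $$n\,QIC(\mathcal N,\rho,\epsilon)=QIC_n(\mathcal N^{\otimes n},\rho^{\otimes n},\epsilon),\qquad n\,QIC^M(\mathcal N,\rho,\epsilon)=QIC^M_n(\mathcal N^{\otimes n},\rho^{\otimes n},\epsilon).$$ -/

import Mathlib

open scoped ComplexOrder Kronecker

/-- A finite-dimensional quantum register, given by the finite set labelling a fixed
orthonormal basis: the register is the Hilbert space `ℂ ^ carrier`. -/
structure Register where
  carrier : Type
  [fin : Fintype carrier]
  [dec : DecidableEq carrier]

instance : CoeSort Register Type := ⟨Register.carrier⟩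

attribute [instance] Register.fin Register.dec

/-- The joint register `A ⊗ B`. -/
abbrev Register.tensor (A B : Register) : Register := ⟨A × B⟩

/-- Density operators on a register. -/
structure DensityOperator (X : Register) where
  mat : Matrix X X ℂ
  posSemidef : mat.PosSemidef
  trace_eq_one : mat.trace = 1

/-- The extension `Φ ⊗ id_R` of a super-operator `Φ`: it acts as `Φ` on each block
`(⟨r| ρ |s⟩)`, for `r`, `s` in the basis of `R`. -/
def ampliation {X Y R : Type*} [Fintype X] [Fintype Y] [Fintype R]
    (Φ : Matrix X X ℂ →ₗ[ℂ] Matrix Y Y ℂ) (ρ : Matrix (X × R) (X × R) ℂ) :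
    Matrix (Y × R) (Y × R) ℂ :=
  Matrix.of fun p q => Φ (Matrix.of fun x x' => ρ (x, p.2) (x', q.2)) p.1 q.1

/-- Quantum channels: completely positive trace-preserving linear maps. -/
structure Channel (X Y : Register) where
  map : Matrix X X ℂ →ₗ[ℂ] Matrix Y Y ℂ
  completelyPositive : ∀ (n : ℕ) (ρ : Matrix (X × Fin n) (X × Fin n) ℂ),
    ρ.PosSemidef → (ampliation map ρ).PosSemidef
  tracePreserving : ∀ ρ : Matrix X X ℂ, (map ρ).trace = ρ.trace

/-- Unitary operators from `ℂ ^ X` onto `ℂ ^ Y`. -/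
structure UnitaryOp (X Y : Type) [Fintype X] [DecidableEq X] [Fintype Y] [DecidableEq Y] where
  mat : Matrix Y X ℂ
  adjoint_mul : mat.conjTranspose * mat = 1
  mul_adjoint : mat * mat.conjTranspose = 1

/-- The trace norm `Tr |D|` of a Hermitian matrix `D`: the sum of the absolute values of its
eigenvalues, with multiplicity. -/
noncomputable def traceNorm {X : Type*} [Fintype X] [DecidableEq X] (D : Matrix X X ℂ) : ℝ :=
  (D.charpoly.roots.map fun z => ‖z‖).sum

/-- The von Neumann entropy `- Tr (ρ log₂ ρ)`: the sum of `- p log₂ p` over the eigenvalues `p`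
of `ρ`, with multiplicity. -/
noncomputable def vonNeumannEntropy {X : Type*} [Fintype X] [DecidableEq X]
    (ρ : Matrix X X ℂ) : ℝ :=
  (ρ.charpoly.roots.map fun z => Real.negMulLog z.re).sum / Real.log 2

/-- The partial trace over the first factor. -/
def traceFirst {X Y : Type*} [Fintype X] (ρ : Matrix (X × Y) (X × Y) ℂ) : Matrix Y Y ℂ :=
  Matrix.of fun y y' => ∑ x, ρ (x, y) (x, y')

/-- The conditional entropy `H(X | Y) = H(XY) - H(Y)` of a state on `X ⊗ Y`. -/
noncomputable def condEntropy {X Y : Type*} [Fintype X] [Fintype Y] [DecidableEq X]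
    [DecidableEq Y] (ρ : Matrix (X × Y) (X × Y) ℂ) : ℝ :=
  vonNeumannEntropy ρ - vonNeumannEntropy (traceFirst ρ)

/-- The conditional mutual information `I(X ; Y | Z) = H(X | Z) - H(X | YZ)` of a state on
`X ⊗ (Y ⊗ Z)`. -/
noncomputable def condMutualInfo {X Y Z : Type*} [Fintype X] [Fintype Y] [Fintype Z]
    [DecidableEq X] [DecidableEq Y] [DecidableEq Z]
    (ρ : Matrix (X × (Y × Z)) (X × (Y × Z)) ℂ) : ℝ :=
  condEntropy (Matrix.of fun (p q : X × Z) => ∑ y, ρ (p.1, (y, p.2)) (q.1, (y, q.2)))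
    - condEntropy ρ

/-- The projection `|v⟩⟨v|`. -/
def pureState {X : Type*} (v : X → ℂ) : Matrix X X ℂ := Matrix.vecMulVec v (star v)

/-- The standard purification `∑ (√ρ)_{x r} |x⟩ |r⟩` of a state `ρ` on `X`, whose reference
register is a copy of `X`. -/
noncomputable def purification {X : Type*} [Fintype X] [DecidableEq X] (ρ : Matrix X X ℂ) :
    X × X → ℂ :=
  fun p => cfc Real.sqrt ρ p.1 p.2

/-- The standard purification of `ρ` is a purification of `ρ`. -/
theorem purification_spec {X : Register} (ρ : DensityOperator X) (x x' : X) :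
    ∑ r, pureState (purification ρ.mat) (x, r) (x', r) = ρ.mat x x' := by
  have hs : IsSelfAdjoint ρ.mat := ρ.posSemidef.isHermitian
  have h1 : IsSelfAdjoint (cfc Real.sqrt ρ.mat) := cfc_predicate _ _
  have h2 : cfc Real.sqrt ρ.mat * cfc Real.sqrt ρ.mat = ρ.mat := by
    rw [← cfc_mul Real.sqrt Real.sqrt ρ.mat]
    conv_rhs => rw [← cfc_id ℝ ρ.mat]
    apply cfc_congr
    intro y hy
    refine Real.mul_self_sqrt ?_
    rw [ρ.posSemidef.isHermitian.spectrum_real_eq_range_eigenvalues] at hy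
    obtain ⟨i, rfl⟩ := hy
    exact ρ.posSemidef.eigenvalues_nonneg i
  conv_rhs => rw [← h2]
  rw [Matrix.mul_apply]
  refine Finset.sum_congr rfl fun r _ => ?_
  have h3 := congrFun (congrFun h1.star_eq r) x'
  rw [Matrix.star_apply] at h3
  simp only [pureState, purification, Matrix.vecMulVec_apply, Pi.star_apply]
  rw [h3]

/-- The rest of a two-party protocol, from the moment when Alice holds the memory `A`, Bob holds
the memory `B`, and a message `C` from Alice is on its way to Bob. Either Bob sends the last
message of the protocol and both keep their output register and a register that is discarded
(`last`), or Bob sends a message to Alice, she sends one to Bob, and the protocol goes on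
(`more`). -/
inductive Rounds (Aout Bout : Register) : Register → Register → Register → Type 1
  | last {A C B : Register} (A' B' C₂ : Register)
      (U : UnitaryOp (B × C) ((Bout × B') × C₂))
      (V : UnitaryOp (A × C₂) (Aout × A')) : Rounds Aout Bout A C B
  | more {A C B : Register} (B₂ C₂ A₃ C₃ : Register)
      (U : UnitaryOp (B × C) (B₂ × C₂))
      (V : UnitaryOp (A × C₂) (A₃ × C₃))
      (rest : Rounds Aout Bout A₃ C₃ B₂) : Rounds Aout Bout A C B

/-- A two-party protocol with an even, positive number of messages, in which Alice sends the
first message: a shared pure state `ψ` on `TA ⊗ TB`, the first unitary of Alice, and the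
remaining unitaries. -/
structure Protocol (Ain Bin Aout Bout : Register) where
  TA : Register
  TB : Register
  ψ : TA × TB → ℂ
  ψ_unit : ∑ t, ‖ψ t‖ ^ 2 = 1
  A₁ : Register
  C₁ : Register
  U₁ : UnitaryOp (Ain × TA) (A₁ × C₁)
  rounds : Rounds Aout Bout A₁ C₁ (Bin.tensor TB)

/-- Bob applies `U` to his memory and the message; `v` is the state of `A ⊗ C ⊗ B ⊗ R`. -/
def bobStep {A C B R C₂ B₂ : Register} (U : UnitaryOp (B × C) (B₂ × C₂))
    (v : A × C × B × R → ℂ) : A × C₂ × B₂ × R → ℂ :=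
  fun (a, c₂, b₂, r) => ∑ p : B × C, U.mat (b₂, c₂) p * v (a, p.2, p.1, r)

/-- Alice applies `V` to her memory and the message. -/
def aliceStep {A C B R C₂ A₂ : Register} (V : UnitaryOp (A × C) (A₂ × C₂))
    (v : A × C × B × R → ℂ) : A₂ × C₂ × B × R → ℂ :=
  fun (a₂, c₂, b, r) => ∑ p : A × C, V.mat (a₂, c₂) p * v (p.1, p.2, b, r)

/-- `I(C ; R | B)` when the pure state of `A ⊗ C ⊗ B ⊗ R` is `v`. -/
noncomputable def infoToBob {A C B R : Register} (v : A × C × B × R → ℂ) : ℝ :=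
  condMutualInfo (Matrix.of fun (p q : C × R × B) =>
    ∑ a, pureState v (a, p.1, p.2.2, p.2.1) (a, q.1, q.2.2, q.2.1))

/-- `I(C ; R | A)` when the pure state of `A ⊗ C ⊗ B ⊗ R` is `v`. -/
noncomputable def infoToAlice {A C B R : Register} (v : A × C × B × R → ℂ) : ℝ :=
  condMutualInfo (Matrix.of fun (p q : C × R × A) =>
    ∑ b, pureState v (p.2.2, p.1, b, p.2.1) (q.2.2, q.1, b, q.2.1))

namespace Rounds

variable {Aout Bout : Register}

/-- The number of messages sent from now on, that of the message on its way included. -/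
def messages : {A C B : Register} → Rounds Aout Bout A C B → ℕ
  | _, _, _, last _ _ _ _ _ => 2
  | _, _, _, more _ _ _ _ _ _ rest => rest.messages + 2

/-- The sum of `½ I(C ; R | B)` for the messages `C` to Bob (the one on its way included) and of
`½ I(C ; R | A)` for the messages `C` to Alice; `v` is the current state of `A ⊗ C ⊗ B ⊗ R`. -/
noncomputable def infoCost : {A C B R : Register} → Rounds Aout Bout A C B →
    (A × C × B × R → ℂ) → ℝ
  | _, _, _, _, last _ B' _ U _, v =>
      infoToBob v / 2 + infoToAlice (bobStep (B₂ := Bout.tensor B') U v) / 2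
  | _, _, _, _, more _ _ _ _ U V rest, v =>
      infoToBob v / 2 + infoToAlice (bobStep U v) / 2
        + rest.infoCost (aliceStep V (bobStep U v))

/-- The state of `Aout ⊗ Bout ⊗ R` at the end of the protocol, the other registers being
traced out. -/
def output : {A C B R : Register} → Rounds Aout Bout A C B → (A × C × B × R → ℂ) →
    Matrix ((Aout × Bout) × R) ((Aout × Bout) × R) ℂ
  | A, _, _, R, last A' B' C₂ U V, v =>
      let w : A × C₂ × (Bout.tensor B') × R → ℂ := bobStep (B₂ := Bout.tensor B') U v
      let z : (Aout × A') × (Bout × B') × R → ℂ := fun (a, b, r) =>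
        ∑ p : A × C₂, V.mat a p * w (p.1, p.2, b, r)
      Matrix.of fun p q => ∑ a' : A', ∑ b' : B',
        pureState z ((p.1.1, a'), (p.1.2, b'), p.2) ((q.1.1, a'), (q.1.2, b'), q.2)
  | _, _, _, _, more _ _ _ _ U V rest, v => rest.output (aliceStep V (bobStep U v))

end Rounds

namespace Protocol

variable {Ain Bin Aout Bout : Register} (P : Protocol Ain Bin Aout Bout)

/-- The number of messages. -/
def messages : ℕ := P.rounds.messages

/-- The state of `A₁ ⊗ C₁ ⊗ (Bin ⊗ TB) ⊗ R` when Alice has applied her first unitary, for the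
pure input state `φ` of `(Ain ⊗ Bin) ⊗ R`. -/
def firstState {R : Register} (φ : (Ain × Bin) × R → ℂ) :
    P.A₁ × P.C₁ × (Bin.tensor P.TB) × R → ℂ :=
  fun (a₁, c₁, b, r) =>
    ∑ p : Ain × P.TA, P.U₁.mat (a₁, c₁) p * (φ ((p.1, b.1), r) * P.ψ (p.2, b.2))

/-- The state `(P ⊗ id_R)(|φ⟩⟨φ|)` of `(Aout ⊗ Bout) ⊗ R` produced by the protocol. -/
def output {R : Register} (φ : (Ain × Bin) × R → ℂ) :
    Matrix ((Aout × Bout) × R) ((Aout × Bout) × R) ℂ :=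
  P.rounds.output (P.firstState φ)

/-- The quantum information cost of the protocol on the input state `ρ`, computed with the
standard purification of `ρ` (all purifications give the same value). -/
noncomputable def infoCost (ρ : Matrix (Ain × Bin) (Ain × Bin) ℂ) : ℝ :=
  P.rounds.infoCost (P.firstState (R := Ain.tensor Bin) (purification ρ))

end Protocol

/-- A quantum task: simulate the channel `N` on the input state `ρ` with error `ε`. -/
structure QTask where
  (Ain Bin Aout Bout : Register)
  N : Channel (Ain.tensor Bin) (Aout.tensor Bout)
  ρ : DensityOperator (Ain.tensor Bin)
  ε : ℝ
  ε_mem : ε ∈ Set.Icc (0 : ℝ) 2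

namespace QTask

variable (t : QTask)

/-- The state `σ` of `(Aout ⊗ Bout) ⊗ R` is `ε`-close to the target state `(N ⊗ id_R)(ρ^R)`,
where `ρ^R` is the standard purification of `ρ`. -/
def IsClose (σ : Matrix ((t.Aout × t.Bout) × (t.Ain × t.Bin))
    ((t.Aout × t.Bout) × (t.Ain × t.Bin)) ℂ) : Prop :=
  traceNorm (σ - ampliation t.N.map (pureState (purification t.ρ.mat))) ≤ t.ε

/-- The protocol `P` simulates `N` on input `ρ` with error at most `ε`. -/
def Succeeds (P : Protocol t.Ain t.Bin t.Aout t.Bout) : Prop :=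
  t.IsClose (P.output (R := t.Ain.tensor t.Bin) (purification t.ρ.mat))

/-- The quantum information complexity `QIC(N, ρ, ε)`. -/
noncomputable def QIC : EReal :=
  ⨅ (P : Protocol t.Ain t.Bin t.Aout t.Bout) (_ : t.Succeeds P), (P.infoCost t.ρ.mat : EReal)

/-- The `M`-message quantum information complexity `QIC^M(N, ρ, ε)`. -/
noncomputable def QICM (M : ℕ) : EReal :=
  ⨅ (P : Protocol t.Ain t.Bin t.Aout t.Bout) (_ : t.Succeeds P ∧ P.messages = M),
    (P.infoCost t.ρ.mat : EReal)

end QTask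

/-- Product quantum tasks. -/
inductive ProductTask : Type 1
  | single (t : QTask) : ProductTask
  | tensor (T₁ T₂ : ProductTask) : ProductTask

/-- Trace out the second halves of four pairs of registers. -/
def keepFirst {A₁ A₂ B₁ B₂ I₁ I₂ J₁ J₂ : Register}
    (σ : Matrix (((A₁ × A₂) × (B₁ × B₂)) × ((I₁ × I₂) × (J₁ × J₂)))
      (((A₁ × A₂) × (B₁ × B₂)) × ((I₁ × I₂) × (J₁ × J₂))) ℂ) :
    Matrix ((A₁ × B₁) × (I₁ × J₁)) ((A₁ × B₁) × (I₁ × J₁)) ℂ :=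
  Matrix.of fun ((a, b), (i, j)) ((a', b'), (i', j')) =>
    ∑ x : A₂, ∑ y : B₂, ∑ k : I₂, ∑ l : J₂,
      σ (((a, x), (b, y)), ((i, k), (j, l))) (((a', x), (b', y)), ((i', k), (j', l)))

/-- Trace out the first halves of four pairs of registers. -/
def keepSecond {A₁ A₂ B₁ B₂ I₁ I₂ J₁ J₂ : Register}
    (σ : Matrix (((A₁ × A₂) × (B₁ × B₂)) × ((I₁ × I₂) × (J₁ × J₂)))
      (((A₁ × A₂) × (B₁ × B₂)) × ((I₁ × I₂) × (J₁ × J₂))) ℂ) :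
    Matrix ((A₂ × B₂) × (I₂ × J₂)) ((A₂ × B₂) × (I₂ × J₂)) ℂ :=
  Matrix.of fun ((a, b), (i, j)) ((a', b'), (i', j')) =>
    ∑ x : A₁, ∑ y : B₁, ∑ k : I₁, ∑ l : J₁,
      σ (((x, a), (y, b)), ((k, i), (l, j))) (((x, a'), (y, b')), ((k, i'), (l, j')))

namespace ProductTask

/-- The joint input register of Alice. -/
def Ain : ProductTask → Register
  | single t => t.Ain
  | tensor T₁ T₂ => T₁.Ain.tensor T₂.Ain

/-- The joint input register of Bob. -/
def Bin : ProductTask → Register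
  | single t => t.Bin
  | tensor T₁ T₂ => T₁.Bin.tensor T₂.Bin

/-- The joint output register of Alice. -/
def Aout : ProductTask → Register
  | single t => t.Aout
  | tensor T₁ T₂ => T₁.Aout.tensor T₂.Aout

/-- The joint output register of Bob. -/
def Bout : ProductTask → Register
  | single t => t.Bout
  | tensor T₁ T₂ => T₁.Bout.tensor T₂.Bout

/-- The input state `ρ₁ ⊗ ⋯ ⊗ ρₙ`, with the registers of Alice and those of Bob grouped. -/
def state : (T : ProductTask) → Matrix (T.Ain × T.Bin) (T.Ain × T.Bin) ℂ
  | single t => t.ρ.mat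
  | tensor T₁ T₂ =>
      (T₁.state ⊗ₖ T₂.state).submatrix
        (Equiv.prodProdProdComm T₁.Ain T₂.Ain T₁.Bin T₂.Bin)
        (Equiv.prodProdProdComm T₁.Ain T₂.Ain T₁.Bin T₂.Bin)

/-- For each component `(Nᵢ, ρᵢ, εᵢ)` of the product task, the marginal of `σ` on the output and
reference registers of that component is `εᵢ`-close to the target state of the component. -/
def IsClose : (T : ProductTask) → Matrix ((T.Aout × T.Bout) × (T.Ain × T.Bin))
    ((T.Aout × T.Bout) × (T.Ain × T.Bin)) ℂ → Prop
  | single t, σ => t.IsClose σ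
  | tensor T₁ T₂, σ =>
      T₁.IsClose (keepFirst (A₂ := T₂.Aout) (B₂ := T₂.Bout) (I₂ := T₂.Ain) (J₂ := T₂.Bin) σ) ∧
      T₂.IsClose (keepSecond (A₁ := T₁.Aout) (B₁ := T₁.Bout) (I₁ := T₁.Ain) (J₁ := T₁.Bin) σ)

variable (T : ProductTask)

/-- The protocol `P`, run on `ρ₁ ⊗ ⋯ ⊗ ρₙ`, simulates every component with its error. -/
def Succeeds (P : Protocol T.Ain T.Bin T.Aout T.Bout) : Prop :=
  T.IsClose (P.output (R := T.Ain.tensor T.Bin) (purification T.state))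

/-- The quantum information complexity of the product task. -/
noncomputable def QIC : EReal :=
  ⨅ (P : Protocol T.Ain T.Bin T.Aout T.Bout) (_ : T.Succeeds P), (P.infoCost T.state : EReal)

/-- The `M`-message quantum information complexity of the product task. -/
noncomputable def QICM (M : ℕ) : EReal :=
  ⨅ (P : Protocol T.Ain T.Bin T.Aout T.Bout) (_ : T.Succeeds P ∧ P.messages = M),
    (P.infoCost T.state : EReal)

end ProductTask

namespace QTask

variable (t : QTask)

/-- The `n`-fold product task `(N, ρ, ε)^{⊗ n}`, for `n ≥ 1` (the value at `0` is immaterial). -/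
def nFold : ℕ → ProductTask
  | 0 => .single t
  | 1 => .single t
  | n + 2 => .tensor (nFold (n + 1)) (.single t)

/-- `QIC_n(N^{⊗ n}, ρ^{⊗ n}, ε)`, for `n ≥ 1`. -/
noncomputable def nFoldQIC (n : ℕ) : EReal := (t.nFold n).QIC

/-- `QIC_n^M(N^{⊗ n}, ρ^{⊗ n}, ε)`, for `n ≥ 1`. -/
noncomputable def nFoldQICM (n M : ℕ) : EReal := (t.nFold n).QICM M

end QTask

/-! Both inequalities come from exact constructions on protocols, with no loss in cost, error or
number of messages.

Upper bound: protocols for the two factors with equally many messages are run in parallel. On pure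
product inputs the joint state stays a product throughout, entropies add, and so do the costs
(`Rounds.exists_par`). When the numbers of messages differ, pairs of messages on a one-dimensional
register are appended; they cost nothing (`Rounds.exists_pad`).

Lower bound: a protocol for the product is cut into two (`Protocol.exists_split`). In the first, the
input of the second factor is replaced by a shared purification of it, whose reference $R_2$ is
handed to Bob; in the second, the input of the first factor is simulated in the same way, and its
reference $R_1$ is handed to Alice. Both run the unitaries of the original protocol, with the extra
register as a spectator. By the chain rule, $I(C;R_1|BR_2)+I(C;R_2|B)=I(C;R_1R_2|B)$ for messages to
Bob and $I(C;R_1|A)+I(C;R_2|AR_1)=I(C;R_1R_2|A)$ for messages to Alice. The opposite choices of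
holder make both identities hold at once, so the two costs add up exactly to the original one
(`infoToBob_chain`, `Rounds.infoCost_extend_add`). The outputs are partial traces of the original
output, which is what the success criterion compares.

The infima live in `EReal`, and no lower bound on costs is established, so strong subadditivity is
not needed. The price is that $\top+\bot=\bot$ must be kept out: an infimum over no protocols must
not meet one that is unbounded below. Every channel has an exact two-message implementation by
dilation (`Channel.exists_protocol`), so with padding every task is solvable for exactly the same
numbers of messages (`iInf_eq_add_iInf`). -/

/-! ### Entropies of marginals of pure states -/

/-- The entropy is invariant under relabelling the basis. -/
theorem vonNeumannEntropy_submatrix {X Y : Type*} [Fintype X] [DecidableEq X] [Fintype Y]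
    [DecidableEq Y] (ρ : Matrix X X ℂ) (e : Y ≃ X) :
    vonNeumannEntropy (ρ.submatrix e e) = vonNeumannEntropy ρ := by
  have h := Matrix.charpoly_reindex e.symm ρ
  rw [Matrix.reindex_apply, Equiv.symm_symm] at h
  rw [vonNeumannEntropy, h, vonNeumannEntropy]

/-- Diagonalising both factors and moving the unitaries around cyclically leaves a Kronecker product
of diagonal matrices. Entropy is defined through roots of the characteristic polynomial, hence this
form. -/
theorem charpoly_kronecker_of_isHermitian {X Y : Type*} [Fintype X] [DecidableEq X] [Fintype Y]
    [DecidableEq Y] {ρ : Matrix X X ℂ} {σ : Matrix Y Y ℂ} (hρ : ρ.IsHermitian)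
    (hσ : σ.IsHermitian) :
    (ρ ⊗ₖ σ).charpoly = ∏ p : X × Y,
      (Polynomial.X - Polynomial.C ((hρ.eigenvalues p.1 * hσ.eigenvalues p.2 : ℝ) : ℂ)) := by
  have h1 := hρ.spectral_theorem
  have h2 := hσ.spectral_theorem
  rw [Unitary.conjStarAlgAut_apply] at h1 h2
  conv_lhs => rw [h1, h2]
  rw [Matrix.mul_kronecker_mul, Matrix.charpoly_mul_comm, Matrix.mul_kronecker_mul, ← mul_assoc,
    ← Matrix.mul_kronecker_mul]
  simp only [Unitary.coe_star_mul_self, Matrix.one_kronecker_one, one_mul,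
    Matrix.diagonal_kronecker_diagonal, Matrix.charpoly_diagonal]
  simp

/-- The entropy is additive on product states. -/
theorem vonNeumannEntropy_kronecker {X Y : Type*} [Fintype X] [DecidableEq X] [Fintype Y]
    [DecidableEq Y] {ρ : Matrix X X ℂ} {σ : Matrix Y Y ℂ} (hρ : ρ.IsHermitian)
    (hσ : σ.IsHermitian) (hρ1 : ρ.trace = 1) (hσ1 : σ.trace = 1) :
    vonNeumannEntropy (ρ ⊗ₖ σ) = vonNeumannEntropy ρ + vonNeumannEntropy σ := by
  have h1 : ∑ i, hρ.eigenvalues i = 1 := by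
    have := hρ.trace_eq_sum_eigenvalues
    rw [hρ1] at this
    apply Complex.ofReal_injective
    push_cast
    exact this.symm
  have h2 : ∑ i, hσ.eigenvalues i = 1 := by
    have := hσ.trace_eq_sum_eigenvalues
    rw [hσ1] at this
    apply Complex.ofReal_injective
    push_cast
    exact this.symm
  have h3 : (ρ ⊗ₖ σ).charpoly.roots = Finset.univ.val.map
      fun p : X × Y => ((hρ.eigenvalues p.1 * hσ.eigenvalues p.2 : ℝ) : ℂ) := by
    rw [charpoly_kronecker_of_isHermitian hρ hσ, Polynomial.roots_prod _ _
      (Finset.prod_ne_zero_iff.2 fun i _ => Polynomial.X_sub_C_ne_zero _)]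
    simp only [Polynomial.roots_X_sub_C, Multiset.bind_singleton]
  simp only [vonNeumannEntropy, h3, hρ.roots_charpoly_eq_eigenvalues,
    hσ.roots_charpoly_eq_eigenvalues, Multiset.map_map]
  rw [← add_div]
  congr 1
  change ∑ p : X × Y, Real.negMulLog (((hρ.eigenvalues p.1 * hσ.eigenvalues p.2 : ℝ) : ℂ).re) =
    ∑ i, Real.negMulLog (((hρ.eigenvalues i : ℝ) : ℂ).re)
      + ∑ j, Real.negMulLog (((hσ.eigenvalues j : ℝ) : ℂ).re)
  -- With $\eta(x)=-x\log x$ one has $\eta(pq)=q\,\eta(p)+p\,\eta(q)$; summing out the free factor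
  -- gives $1$ by the trace conditions.
  simp only [Complex.ofReal_re, Real.negMulLog_mul, Fintype.sum_prod_type,
    Finset.sum_add_distrib, ← Finset.sum_mul, ← Finset.mul_sum, h1, h2, one_mul]

/-- The marginal on `S` of the vector `v` of `S ⊗ T`. -/
def marginal {S T : Type*} [Fintype T] (v : S × T → ℂ) : Matrix S S ℂ :=
  Matrix.of fun s s' => ∑ t, v (s, t) * star (v (s', t))

theorem marginal_isHermitian {S T : Type*} [Fintype T] (v : S × T → ℂ) :
    (marginal v).IsHermitian := by
  ext s s'
  simp [marginal, mul_comm]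

theorem marginal_trace {S T : Type*} [Fintype S] [Fintype T] (v : S × T → ℂ) :
    (marginal v).trace = ∑ p, v p * star (v p) := by
  simp [marginal, Matrix.trace, Fintype.sum_prod_type]

/-- The entropy of the marginal on `S` of the vector `v` of `S ⊗ T`. -/
noncomputable def marginalEntropy {S T : Type*} [Fintype S] [DecidableEq S] [Fintype T]
    (v : S × T → ℂ) : ℝ :=
  vonNeumannEntropy (marginal v)

theorem marginalEntropy_congr {S T S' T' : Type*} [Fintype S] [DecidableEq S] [Fintype T]
    [Fintype S'] [DecidableEq S'] [Fintype T'] {v : S × T → ℂ} {w : S' × T' → ℂ}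
    (e : S ≃ S') (f : T ≃ T') (h : ∀ s t, v (s, t) = w (e s, f t)) :
    marginalEntropy v = marginalEntropy w := by
  rw [marginalEntropy, marginalEntropy, ← vonNeumannEntropy_submatrix (marginal w) e]
  congr 1
  ext s s'
  simp only [marginal, Matrix.of_apply, Matrix.submatrix_apply, h]
  exact Equiv.sum_comp f fun t => w (e s, t) * star (w (e s', t))

/-- A unit vector. -/
def IsUnitVector {S : Type*} [Fintype S] (v : S → ℂ) : Prop := ∑ p, v p * star (v p) = 1

theorem IsUnitVector.comp_equiv {S T : Type*} [Fintype S] [Fintype T] {v : S → ℂ}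
    (h : IsUnitVector v) (e : T ≃ S) : IsUnitVector (fun t => v (e t)) :=
  (Equiv.sum_comp e fun s => v s * star (v s)).trans h

theorem IsUnitVector.tensor {S T : Type*} [Fintype S] [Fintype T] {v : S → ℂ} {w : T → ℂ}
    (hv : IsUnitVector v) (hw : IsUnitVector w) :
    IsUnitVector (fun p : S × T => v p.1 * w p.2) := by
  have : ∑ p : S × T, v p.1 * w p.2 * star (v p.1 * w p.2)
      = (∑ s, v s * star (v s)) * ∑ t, w t * star (w t) := by
    rw [Finset.sum_mul_sum, Fintype.sum_prod_type]
    refine Finset.sum_congr rfl fun s _ => Finset.sum_congr rfl fun t _ => ?_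
    rw [star_mul']
    ring
  rw [IsUnitVector, this, hv, hw, one_mul]

theorem isUnitVector_iff {S : Type*} [Fintype S] (v : S → ℂ) :
    IsUnitVector v ↔ ∑ s, ‖v s‖ ^ 2 = 1 := by
  have : ∑ s, v s * star (v s) = ((∑ s, ‖v s‖ ^ 2 : ℝ) : ℂ) := by
    push_cast
    exact Finset.sum_congr rfl fun s _ => Complex.mul_conj' (v s)
  rw [IsUnitVector, this]
  norm_cast

/-- The marginal entropy is additive on products of unit vectors. -/
theorem marginalEntropy_tensor {S T S₁ T₁ S₂ T₂ : Type*} [Fintype S] [DecidableEq S] [Fintype T]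
    [Fintype S₁] [DecidableEq S₁] [Fintype T₁] [Fintype S₂] [DecidableEq S₂] [Fintype T₂]
    {v : S × T → ℂ} {v₁ : S₁ × T₁ → ℂ} {v₂ : S₂ × T₂ → ℂ}
    (e : S ≃ S₁ × S₂) (f : T ≃ T₁ × T₂)
    (h : ∀ s t, v (s, t) = v₁ ((e s).1, (f t).1) * v₂ ((e s).2, (f t).2))
    (h₁ : IsUnitVector v₁) (h₂ : IsUnitVector v₂) :
    marginalEntropy v = marginalEntropy v₁ + marginalEntropy v₂ := by
  rw [marginalEntropy, marginalEntropy, marginalEntropy,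
    ← vonNeumannEntropy_kronecker (marginal_isHermitian _) (marginal_isHermitian _)
      ((marginal_trace _).trans h₁) ((marginal_trace _).trans h₂),
    ← vonNeumannEntropy_submatrix _ e]
  congr 1
  ext s s'
  simp only [marginal, Matrix.of_apply, Matrix.submatrix_apply, h, Matrix.kroneckerMap_apply,
    Finset.sum_mul_sum]
  rw [← Equiv.sum_comp f.symm, Fintype.sum_prod_type]
  refine Finset.sum_congr rfl fun t _ => Finset.sum_congr rfl fun u _ => ?_
  simp only [Equiv.apply_symm_apply, star_mul']
  ring

/-- This is $H(CB)-H(B)-H(CRB)+H(RB)$. Displaying each term with its complementary registers lets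
`marginalEntropy_congr` and `marginalEntropy_tensor` act directly on the vector. -/
theorem infoToBob_eq {A C B R : Register} (v : A × C × B × R → ℂ) :
    infoToBob v =
      marginalEntropy (fun p : (C × B) × (R × A) => v (p.2.2, p.1.1, p.1.2, p.2.1))
      - marginalEntropy (fun p : B × (C × R × A) => v (p.2.2.2, p.2.1, p.1, p.2.2.1))
      - (marginalEntropy (fun p : (C × R × B) × A => v (p.2, p.1.1, p.1.2.2, p.1.2.1))
      - marginalEntropy (fun p : (R × B) × (C × A) => v (p.2.2, p.2.1, p.1.2, p.1.1))) := by
  simp only [infoToBob, condMutualInfo, condEntropy, marginalEntropy]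
  congr 2 <;> congr 1 <;> ext s s' <;>
    simp [marginal, traceFirst, pureState, Matrix.vecMulVec_apply, Fintype.sum_prod_type]

/-- Exchange the memories of Alice and Bob. -/
def swapMemories {A C B R : Register} (v : A × C × B × R → ℂ) : B × C × A × R → ℂ :=
  fun p => v (p.2.2.1, p.2.1, p.1, p.2.2.2)

/-- Through this symmetry, facts about messages to Alice are obtained from those about messages to
Bob. -/
theorem infoToAlice_eq_swapMemories {A C B R : Register} (v : A × C × B × R → ℂ) :
    infoToAlice v = infoToBob (swapMemories v) :=
  rfl

/-- If the reference `R` is split into `R₁` and `R₂` and Bob holds `R₂` in `v₁`, while Alice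
holds `R₁` in `v₂`, then `I(C ; R | B) = I(C ; R₁ | B R₂) + I(C ; R₂ | B)`. -/
theorem infoToBob_chain {A C B R R₁ R₂ A₁ B₁ A₂ B₂ : Register} {v : A × C × B × R → ℂ}
    {v₁ : A₁ × C × B₁ × R₁ → ℂ} {v₂ : A₂ × C × B₂ × R₂ → ℂ}
    (α₁ : A₁ ≃ A) (β₁ : B₁ ≃ B × R₂) (α₂ : A₂ ≃ A × R₁) (β₂ : B₂ ≃ B) (g : R₁ × R₂ ≃ R)
    (h₁ : ∀ a c b r, v₁ (a, c, b, r) = v (α₁ a, c, (β₁ b).1, g (r, (β₁ b).2)))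
    (h₂ : ∀ a c b r, v₂ (a, c, b, r) = v ((α₂ a).1, c, β₂ b, g ((α₂ a).2, r))) :
    infoToBob v₁ + infoToBob v₂ = infoToBob v := by
  let q₁ : R₁ × B₁ ≃ R × B :=
    { toFun := fun p => (g (p.1, (β₁ p.2).2), (β₁ p.2).1)
      invFun := fun p => ((g.symm p.1).1, β₁.symm (p.2, (g.symm p.1).2))
      left_inv := fun p => by simp
      right_inv := fun p => by simp }
  let q₂ : R₂ × A₂ ≃ R × A :=
    { toFun := fun p => (g ((α₂ p.2).2, p.1), (α₂ p.2).1)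
      invFun := fun p => ((g.symm p.1).2, α₂.symm (p.2, (g.symm p.1).1))
      left_inv := fun p => by simp
      right_inv := fun p => by simp }
  let s : B₁ ≃ R₂ × B₂ :=
    (β₁.trans (Equiv.prodComm B R₂)).trans ((Equiv.refl R₂).prodCongr β₂.symm)
  let t : R₁ × A₁ ≃ A₂ :=
    ((Equiv.prodComm R₁ A₁).trans (α₁.prodCongr (Equiv.refl R₁))).trans α₂.symm
  -- `e₁` and `e₂` match the terms that cancel: $H(CBR_2)$ and $H(BR_2)$ occur in both summands with
  -- opposite signs. The remaining equalities identify the surviving four terms with those of `v`.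
  have e₁ := marginalEntropy_congr
    (v := fun p : (C × B₁) × (R₁ × A₁) => v₁ (p.2.2, p.1.1, p.1.2, p.2.1))
    (w := fun p : (C × R₂ × B₂) × A₂ => v₂ (p.2, p.1.1, p.1.2.2, p.1.2.1))
    ((Equiv.refl C).prodCongr s) t (fun p q => by simp [h₁, h₂, s, t])
  have e₂ := marginalEntropy_congr
    (v := fun p : B₁ × (C × R₁ × A₁) => v₁ (p.2.2.2, p.2.1, p.1, p.2.2.1))
    (w := fun p : (R₂ × B₂) × (C × A₂) => v₂ (p.2.2, p.2.1, p.1.2, p.1.1))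
    s ((Equiv.refl C).prodCongr t) (fun p q => by simp [h₁, h₂, s, t])
  have e₃ := marginalEntropy_congr
    (v := fun p : (C × R₁ × B₁) × A₁ => v₁ (p.2, p.1.1, p.1.2.2, p.1.2.1))
    (w := fun p : (C × R × B) × A => v (p.2, p.1.1, p.1.2.2, p.1.2.1))
    ((Equiv.refl C).prodCongr q₁) α₁ (fun p q => by simp [h₁, q₁])
  have e₄ := marginalEntropy_congr
    (v := fun p : (R₁ × B₁) × (C × A₁) => v₁ (p.2.2, p.2.1, p.1.2, p.1.1))
    (w := fun p : (R × B) × (C × A) => v (p.2.2, p.2.1, p.1.2, p.1.1))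
    q₁ ((Equiv.refl C).prodCongr α₁) (fun p q => by simp [h₁, q₁])
  have e₅ := marginalEntropy_congr
    (v := fun p : (C × B₂) × (R₂ × A₂) => v₂ (p.2.2, p.1.1, p.1.2, p.2.1))
    (w := fun p : (C × B) × (R × A) => v (p.2.2, p.1.1, p.1.2, p.2.1))
    ((Equiv.refl C).prodCongr β₂) q₂ (fun p q => by simp [h₂, q₂])
  have e₆ := marginalEntropy_congr
    (v := fun p : B₂ × (C × R₂ × A₂) => v₂ (p.2.2.2, p.2.1, p.1, p.2.2.1))
    (w := fun p : B × (C × R × A) => v (p.2.2.2, p.2.1, p.1, p.2.2.1))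
    β₂ ((Equiv.refl C).prodCongr q₂) (fun p q => by simp [h₂, q₂])
  rw [infoToBob_eq, infoToBob_eq, infoToBob_eq, e₁, e₂, e₃, e₄, e₅, e₆]
  ring

/-- The information cost of a message is additive on products of unit vectors. -/
theorem infoToBob_tensor {A C B R A₁ C₁ B₁ R₁ A₂ C₂ B₂ R₂ : Register} {v : A × C × B × R → ℂ}
    {v₁ : A₁ × C₁ × B₁ × R₁ → ℂ} {v₂ : A₂ × C₂ × B₂ × R₂ → ℂ}
    (α : A ≃ A₁ × A₂) (κ : C ≃ C₁ × C₂) (β : B ≃ B₁ × B₂) (γ : R ≃ R₁ × R₂)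
    (h : ∀ a c b r, v (a, c, b, r) =
      v₁ ((α a).1, (κ c).1, (β b).1, (γ r).1) * v₂ ((α a).2, (κ c).2, (β b).2, (γ r).2))
    (h₁ : IsUnitVector v₁) (h₂ : IsUnitVector v₂) :
    infoToBob v = infoToBob v₁ + infoToBob v₂ := by
  let pr {X X₁ X₂ Y Y₁ Y₂ : Type} (e : X ≃ X₁ × X₂) (f : Y ≃ Y₁ × Y₂) :
      X × Y ≃ (X₁ × Y₁) × (X₂ × Y₂) :=
    (e.prodCongr f).trans (Equiv.prodProdProdComm X₁ X₂ Y₁ Y₂)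
  let f₁ {A C B R : Register} : (C × B) × (R × A) ≃ A × C × B × R :=
    ⟨fun p => (p.2.2, p.1.1, p.1.2, p.2.1), fun p => ((p.2.1, p.2.2.1), (p.2.2.2, p.1)),
      fun _ => rfl, fun _ => rfl⟩
  let f₂ {A C B R : Register} : B × (C × R × A) ≃ A × C × B × R :=
    ⟨fun p => (p.2.2.2, p.2.1, p.1, p.2.2.1), fun p => (p.2.2.1, (p.2.1, p.2.2.2, p.1)),
      fun _ => rfl, fun _ => rfl⟩
  let f₃ {A C B R : Register} : (C × R × B) × A ≃ A × C × B × R :=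
    ⟨fun p => (p.2, p.1.1, p.1.2.2, p.1.2.1), fun p => ((p.2.1, p.2.2.2, p.2.2.1), p.1),
      fun _ => rfl, fun _ => rfl⟩
  let f₄ {A C B R : Register} : (R × B) × (C × A) ≃ A × C × B × R :=
    ⟨fun p => (p.2.2, p.2.1, p.1.2, p.1.1), fun p => ((p.2.2.2, p.2.2.1), (p.2.1, p.1)),
      fun _ => rfl, fun _ => rfl⟩
  have e₁ := marginalEntropy_tensor
    (v := fun p : (C × B) × (R × A) => v (p.2.2, p.1.1, p.1.2, p.2.1))
    (pr κ β) (pr γ α) (fun _ _ => h _ _ _ _) (h₁.comp_equiv f₁) (h₂.comp_equiv f₁)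
  have e₂ := marginalEntropy_tensor
    (v := fun p : B × (C × R × A) => v (p.2.2.2, p.2.1, p.1, p.2.2.1))
    β (pr κ (pr γ α)) (fun _ _ => h _ _ _ _) (h₁.comp_equiv f₂) (h₂.comp_equiv f₂)
  have e₃ := marginalEntropy_tensor
    (v := fun p : (C × R × B) × A => v (p.2, p.1.1, p.1.2.2, p.1.2.1))
    (pr κ (pr γ β)) α (fun _ _ => h _ _ _ _) (h₁.comp_equiv f₃) (h₂.comp_equiv f₃)
  have e₄ := marginalEntropy_tensor
    (v := fun p : (R × B) × (C × A) => v (p.2.2, p.2.1, p.1.2, p.1.1))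
    (pr γ β) (pr κ α) (fun _ _ => h _ _ _ _) (h₁.comp_equiv f₄) (h₂.comp_equiv f₄)
  rw [infoToBob_eq, infoToBob_eq, infoToBob_eq, e₁, e₂, e₃, e₄]
  simp only [f₁, f₂, f₃, f₄, Equiv.coe_fn_mk]
  ring

/-- A trivial message carries no information. -/
theorem infoToBob_of_unique {A C B R : Register} [Unique C] (v : A × C × B × R → ℂ) :
    infoToBob v = 0 := by
  rw [infoToBob_eq]
  have e₁ := marginalEntropy_congr
    (v := fun p : (C × B) × (R × A) => v (p.2.2, p.1.1, p.1.2, p.2.1))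
    (w := fun p : B × (C × R × A) => v (p.2.2.2, p.2.1, p.1, p.2.2.1))
    (Equiv.uniqueProd B C) (Equiv.uniqueProd (R × A) C).symm
    (fun p q => by simp [Unique.eq_default p.1])
  have e₂ := marginalEntropy_congr
    (v := fun p : (C × R × B) × A => v (p.2, p.1.1, p.1.2.2, p.1.2.1))
    (w := fun p : (R × B) × (C × A) => v (p.2.2, p.2.1, p.1.2, p.1.1))
    (Equiv.uniqueProd (R × B) C) (Equiv.uniqueProd A C).symm
    (fun p q => by simp [Unique.eq_default p.1])
  rw [e₁, e₂]
  ring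

/-! ### Unitary operators and the steps of a protocol -/

namespace UnitaryOp

variable {X Y X₁ Y₁ X₂ Y₂ : Type} [Fintype X] [DecidableEq X] [Fintype Y] [DecidableEq Y]
  [Fintype X₁] [DecidableEq X₁] [Fintype Y₁] [DecidableEq Y₁]
  [Fintype X₂] [DecidableEq X₂] [Fintype Y₂] [DecidableEq Y₂]

/-- The unitary that sends the basis vector `x` to the basis vector `e x`. -/
def ofEquiv (e : X ≃ Y) : UnitaryOp X Y where
  mat := (1 : Matrix Y Y ℂ).submatrix id e
  adjoint_mul := by
    rw [Matrix.conjTranspose_submatrix, ← Matrix.submatrix_mul _ _ e id e Function.bijective_id]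
    simp
  mul_adjoint := by
    rw [Matrix.conjTranspose_submatrix, ← Matrix.submatrix_mul _ _ id e id e.bijective]
    simp

theorem ofEquiv_sum (e : X ≃ Y) (y : Y) (w : X → ℂ) :
    ∑ x, (ofEquiv e).mat y x * w x = w (e.symm y) := by
  rw [← Equiv.sum_comp e.symm]
  simp [ofEquiv, Matrix.one_apply]

/-- The tensor product of two unitaries, with relabelled bases. -/
def par (U : UnitaryOp X₁ Y₁) (V : UnitaryOp X₂ Y₂) (e : X ≃ X₁ × X₂) (f : Y ≃ Y₁ × Y₂) :
    UnitaryOp X Y where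
  mat := (U.mat ⊗ₖ V.mat).submatrix f e
  adjoint_mul := by
    rw [Matrix.conjTranspose_submatrix, ← Matrix.submatrix_mul _ _ e f e f.bijective,
      Matrix.conjTranspose_kronecker, ← Matrix.mul_kronecker_mul, U.adjoint_mul, V.adjoint_mul]
    simp
  mul_adjoint := by
    rw [Matrix.conjTranspose_submatrix, ← Matrix.submatrix_mul _ _ f e f e.bijective,
      Matrix.conjTranspose_kronecker, ← Matrix.mul_kronecker_mul, U.mul_adjoint, V.mul_adjoint]
    simp

theorem par_sum (U : UnitaryOp X₁ Y₁) (V : UnitaryOp X₂ Y₂) (e : X ≃ X₁ × X₂)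
    (f : Y ≃ Y₁ × Y₂) (y : Y) (w : X → ℂ) (w₁ : X₁ → ℂ) (w₂ : X₂ → ℂ)
    (h : ∀ x, w x = w₁ (e x).1 * w₂ (e x).2) :
    ∑ x, (U.par V e f).mat y x * w x =
      (∑ x, U.mat (f y).1 x * w₁ x) * ∑ x, V.mat (f y).2 x * w₂ x := by
  rw [← Equiv.sum_comp e.symm, Fintype.sum_prod_type, Finset.sum_mul_sum]
  refine Finset.sum_congr rfl fun s _ => Finset.sum_congr rfl fun t _ => ?_
  simp only [par, h, Matrix.submatrix_apply, Equiv.apply_symm_apply, Matrix.kroneckerMap_apply]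
  ring

/-- `U ⊗ 1`, with relabelled bases. -/
def spectate (U : UnitaryOp X₁ Y₁) (e : X ≃ X₁ × X₂) (f : Y ≃ Y₁ × X₂) : UnitaryOp X Y :=
  U.par (ofEquiv (Equiv.refl X₂)) e f

theorem spectate_sum (U : UnitaryOp X₁ Y₁) (e : X ≃ X₁ × X₂) (f : Y ≃ Y₁ × X₂) (y : Y)
    (w : X → ℂ) :
    ∑ x, (U.spectate e f).mat y x * w x =
      ∑ x, U.mat (f y).1 x * w (e.symm (x, (f y).2)) := by
  rw [← Equiv.sum_comp e.symm, Fintype.sum_prod_type]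
  refine Finset.sum_congr rfl fun s _ => ?_
  simp [spectate, par, ofEquiv, Matrix.one_apply]

/-- A unitary acting on one half of a unit vector produces a unit vector. -/
theorem isUnitVector_apply {Z : Type*} [Fintype Z] (U : UnitaryOp X Y) {w : X × Z → ℂ}
    (hw : IsUnitVector w) :
    IsUnitVector (fun p : Y × Z => ∑ x, U.mat p.1 x * w (x, p.2)) := by
  unfold IsUnitVector at hw ⊢
  rw [← hw, Fintype.sum_prod_type_right, Fintype.sum_prod_type_right]
  refine Finset.sum_congr rfl fun z _ => ?_
  change (U.mat.mulVec fun x => w (x, z)) ⬝ᵥ star (U.mat.mulVec fun x => w (x, z)) =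
    (fun x => w (x, z)) ⬝ᵥ star (fun x => w (x, z))
  rw [Matrix.star_mulVec, dotProduct_comm, ← Matrix.dotProduct_mulVec, Matrix.mulVec_mulVec,
    U.adjoint_mul, Matrix.one_mulVec, dotProduct_comm]

end UnitaryOp

/-! ### Unit vectors, spectator registers and product vectors under the steps of the parties -/

theorem IsUnitVector.bobStep {A C B R C₂ B₂ : Register} (U : UnitaryOp (B × C) (B₂ × C₂))
    {v : A × C × B × R → ℂ} (hv : IsUnitVector v) : IsUnitVector (bobStep U v) := by
  let f {C B : Register} : (B × C) × (A × R) ≃ A × C × B × R :=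
    ⟨fun p => (p.2.1, p.1.2, p.1.1, p.2.2), fun p => ((p.2.2.1, p.2.1), (p.1, p.2.2.2)),
      fun _ => rfl, fun _ => rfl⟩
  exact (U.isUnitVector_apply (hv.comp_equiv f)).comp_equiv f.symm

theorem IsUnitVector.swapMemories {A C B R : Register} {v : A × C × B × R → ℂ}
    (hv : IsUnitVector v) : IsUnitVector (swapMemories v) :=
  let f : B × C × A × R ≃ A × C × B × R :=
    ⟨fun p => (p.2.2.1, p.2.1, p.1, p.2.2.2), fun p => (p.2.2.1, p.2.1, p.1, p.2.2.2),
      fun _ => rfl, fun _ => rfl⟩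
  hv.comp_equiv f

theorem IsUnitVector.aliceStep {A C B R C₂ A₂ : Register} (V : UnitaryOp (A × C) (A₂ × C₂))
    {v : A × C × B × R → ℂ} (hv : IsUnitVector v) : IsUnitVector (aliceStep V v) :=
  (hv.swapMemories.bobStep V).swapMemories

/-- In `v'` Alice and Bob hold the registers `EA` and `EB`, which belong to the reference in
`v`. -/
def SplitsReference {A C B R A₁ B₁ R₁ EA EB : Register} (α : A₁ ≃ A × EA) (β : B₁ ≃ B × EB)
    (g : R₁ × EA × EB ≃ R) (v : A × C × B × R → ℂ) (v' : A₁ × C × B₁ × R₁ → ℂ) : Prop :=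
  ∀ a c b r, v' (a, c, b, r) = v ((α a).1, c, (β b).1, g (r, (α a).2, (β b).2))

/-- Attach a spectator register to the memory of the sender. -/
def memoryEquiv {B C B₁ E : Type} (β : B₁ ≃ B × E) : B₁ × C ≃ (B × C) × E :=
  (β.prodCongr (Equiv.refl C)).trans ⟨fun p => ((p.1.1, p.2), p.1.2), fun p => ((p.1.1, p.2), p.1.2),
    fun _ => rfl, fun _ => rfl⟩

/-- The unitary acts as $U\otimes 1$ on the spectator, so it commutes with the regrouping of the
reference. The layout `β'` of the new memory is left free because the last round stores it
differently, through `outputEquiv`. -/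
theorem SplitsReference.bobStep {A C B R A₁ B₁ R₁ EA EB B₂ C₂ B₃ : Register}
    {α : A₁ ≃ A × EA} {β : B₁ ≃ B × EB} {g : R₁ × EA × EB ≃ R} {v : A × C × B × R → ℂ}
    {v' : A₁ × C × B₁ × R₁ → ℂ} (h : SplitsReference α β g v v')
    (U : UnitaryOp (B × C) (B₂ × C₂)) (β' : B₃ ≃ B₂ × EB) :
    SplitsReference α β' g (bobStep U v)
      (bobStep (U.spectate (memoryEquiv β) (memoryEquiv β')) v') := by
  intro a c b r
  simp only [_root_.bobStep]
  rw [UnitaryOp.spectate_sum]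
  refine Finset.sum_congr rfl fun p _ => ?_
  simp [memoryEquiv, h _ _ _ _]

theorem SplitsReference.aliceStep {A C B R A₁ B₁ R₁ EA EB A₂ C₂ A₃ : Register}
    {α : A₁ ≃ A × EA} {β : B₁ ≃ B × EB} {g : R₁ × EA × EB ≃ R} {v : A × C × B × R → ℂ}
    {v' : A₁ × C × B₁ × R₁ → ℂ} (h : SplitsReference α β g v v')
    (V : UnitaryOp (A × C) (A₂ × C₂)) (α' : A₃ ≃ A₂ × EA) :
    SplitsReference α' β g (aliceStep V v)
      (aliceStep (V.spectate (memoryEquiv α) (memoryEquiv α')) v') := by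
  intro a c b r
  simp only [_root_.aliceStep]
  rw [UnitaryOp.spectate_sum]
  refine Finset.sum_congr rfl fun p _ => ?_
  simp [memoryEquiv, h _ _ _ _]

/-- The vector `v` is the product of `v₁` and `v₂`. -/
def IsTensor {A C B R A₁ C₁ B₁ R₁ A₂ C₂ B₂ R₂ : Register}
    (α : A ≃ A₁ × A₂) (κ : C ≃ C₁ × C₂) (β : B ≃ B₁ × B₂) (γ : R ≃ R₁ × R₂)
    (v₁ : A₁ × C₁ × B₁ × R₁ → ℂ) (v₂ : A₂ × C₂ × B₂ × R₂ → ℂ) (v : A × C × B × R → ℂ) : Prop :=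
  ∀ a c b r, v (a, c, b, r) =
    v₁ ((α a).1, (κ c).1, (β b).1, (γ r).1) * v₂ ((α a).2, (κ c).2, (β b).2, (γ r).2)

/-- Two registers `B ⊗ C`, each of them split in two. -/
def pairEquiv {B C B₁ C₁ B₂ C₂ : Type} (β : B ≃ B₁ × B₂) (κ : C ≃ C₁ × C₂) :
    B × C ≃ (B₁ × C₁) × (B₂ × C₂) :=
  (β.prodCongr κ).trans (Equiv.prodProdProdComm B₁ B₂ C₁ C₂)

theorem IsTensor.bobStep {A C B R A₁ C₁ B₁ R₁ A₂ C₂ B₂ R₂ C' B' C₁' B₁' C₂' B₂' : Register}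
    {α : A ≃ A₁ × A₂} {κ : C ≃ C₁ × C₂} {β : B ≃ B₁ × B₂} {γ : R ≃ R₁ × R₂}
    {v₁ : A₁ × C₁ × B₁ × R₁ → ℂ} {v₂ : A₂ × C₂ × B₂ × R₂ → ℂ} {v : A × C × B × R → ℂ}
    (h : IsTensor α κ β γ v₁ v₂ v) (U₁ : UnitaryOp (B₁ × C₁) (B₁' × C₁'))
    (U₂ : UnitaryOp (B₂ × C₂) (B₂' × C₂')) (κ' : C' ≃ C₁' × C₂') (β' : B' ≃ B₁' × B₂') :
    IsTensor α κ' β' γ (bobStep U₁ v₁) (bobStep U₂ v₂)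
      (bobStep (U₁.par U₂ (pairEquiv β κ) (pairEquiv β' κ')) v) := by
  intro a c b r
  simp only [_root_.bobStep]
  exact UnitaryOp.par_sum _ _ _ _ _ _ (fun p : B₁ × C₁ => v₁ ((α a).1, p.2, p.1, (γ r).1))
    (fun p : B₂ × C₂ => v₂ ((α a).2, p.2, p.1, (γ r).2)) fun _ => h _ _ _ _

theorem IsTensor.swapMemories {A C B R A₁ C₁ B₁ R₁ A₂ C₂ B₂ R₂ : Register}
    {α : A ≃ A₁ × A₂} {κ : C ≃ C₁ × C₂} {β : B ≃ B₁ × B₂} {γ : R ≃ R₁ × R₂}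
    {v₁ : A₁ × C₁ × B₁ × R₁ → ℂ} {v₂ : A₂ × C₂ × B₂ × R₂ → ℂ} {v : A × C × B × R → ℂ}
    (h : IsTensor α κ β γ v₁ v₂ v) :
    IsTensor β κ α γ (swapMemories v₁) (swapMemories v₂) (swapMemories v) :=
  fun _ _ _ _ => h _ _ _ _

theorem IsTensor.aliceStep {A C B R A₁ C₁ B₁ R₁ A₂ C₂ B₂ R₂ C' A' C₁' A₁' C₂' A₂' : Register}
    {α : A ≃ A₁ × A₂} {κ : C ≃ C₁ × C₂} {β : B ≃ B₁ × B₂} {γ : R ≃ R₁ × R₂}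
    {v₁ : A₁ × C₁ × B₁ × R₁ → ℂ} {v₂ : A₂ × C₂ × B₂ × R₂ → ℂ} {v : A × C × B × R → ℂ}
    (h : IsTensor α κ β γ v₁ v₂ v) (U₁ : UnitaryOp (A₁ × C₁) (A₁' × C₁'))
    (U₂ : UnitaryOp (A₂ × C₂) (A₂' × C₂')) (κ' : C' ≃ C₁' × C₂') (α' : A' ≃ A₁' × A₂') :
    IsTensor α' κ' β γ (aliceStep U₁ v₁) (aliceStep U₂ v₂)
      (aliceStep (U₁.par U₂ (pairEquiv α κ) (pairEquiv α' κ')) v) :=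
  (h.swapMemories.bobStep U₁ U₂ κ' α').swapMemories

/-! ### Transformations of the rounds of a protocol -/

/-- The trivial register. -/
abbrev Register.one : Register := ⟨Unit⟩

/-- The chain rule for the two protocols of the lower bound. The trivial register stands for the
party that receives no part of the reference, so that one notion of splitting serves both; `hg` says
that both cut $R$ into $R_1$ and $R_2$ in the same way. -/
theorem SplitsReference.infoToBob_add {A C B R A₁ B₁ R₁ A₂ B₂ R₂ : Register}
    {α₁ : A₁ ≃ A × Register.one} {β₁ : B₁ ≃ B × R₂} {g₁ : R₁ × Register.one × R₂ ≃ R}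
    {α₂ : A₂ ≃ A × R₁} {β₂ : B₂ ≃ B × Register.one} {g₂ : R₂ × R₁ × Register.one ≃ R}
    {v : A × C × B × R → ℂ} {v₁ : A₁ × C × B₁ × R₁ → ℂ} {v₂ : A₂ × C × B₂ × R₂ → ℂ}
    (hg : ∀ r₁ r₂, g₁ (r₁, (), r₂) = g₂ (r₂, r₁, ()))
    (h₁ : SplitsReference α₁ β₁ g₁ v v₁) (h₂ : SplitsReference α₂ β₂ g₂ v v₂) :
    infoToBob v₁ + infoToBob v₂ = infoToBob v := by
  let g₀ : R₁ × R₂ ≃ R₁ × Register.one × R₂ :=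
    ⟨fun p => (p.1, (), p.2), fun p => (p.1, p.2.2), fun _ => rfl, fun _ => rfl⟩
  exact infoToBob_chain (α₁.trans (Equiv.prodPUnit A)) β₁ α₂ (β₂.trans (Equiv.prodPUnit B))
    (g₀.trans g₁) h₁ fun a c b r => (h₂ a c b r).trans (by rw [← hg]; rfl)

theorem SplitsReference.swapMemories {A C B R A₁ B₁ R₁ EA EB : Register} {α : A₁ ≃ A × EA}
    {β : B₁ ≃ B × EB} {g : R₁ × EA × EB ≃ R} {v : A × C × B × R → ℂ}
    {v' : A₁ × C × B₁ × R₁ → ℂ} (h : SplitsReference α β g v v') :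
    SplitsReference β α (((Equiv.refl R₁).prodCongr (Equiv.prodComm EB EA)).trans g)
      (swapMemories v) (swapMemories v') :=
  fun _ _ _ _ => h _ _ _ _

/-- The configuration "Bob holds $R_2$ in the first, Alice holds $R_1$ in the second" is invariant
under exchanging the parties together with the two protocols. -/
theorem SplitsReference.infoToAlice_add {A C B R A₁ B₁ R₁ A₂ B₂ R₂ : Register}
    {α₁ : A₁ ≃ A × Register.one} {β₁ : B₁ ≃ B × R₂} {g₁ : R₁ × Register.one × R₂ ≃ R}
    {α₂ : A₂ ≃ A × R₁} {β₂ : B₂ ≃ B × Register.one} {g₂ : R₂ × R₁ × Register.one ≃ R}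
    {v : A × C × B × R → ℂ} {v₁ : A₁ × C × B₁ × R₁ → ℂ} {v₂ : A₂ × C × B₂ × R₂ → ℂ}
    (hg : ∀ r₁ r₂, g₁ (r₁, (), r₂) = g₂ (r₂, r₁, ()))
    (h₁ : SplitsReference α₁ β₁ g₁ v v₁) (h₂ : SplitsReference α₂ β₂ g₂ v v₂) :
    infoToAlice v₁ + infoToAlice v₂ = infoToAlice v := by
  simp only [infoToAlice_eq_swapMemories]
  rw [add_comm]
  have k₁ := h₁.swapMemories
  have k₂ := h₂.swapMemories
  refine SplitsReference.infoToBob_add (A := B) (B := A) ?_ k₂ k₁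
  exact fun r₂ r₁ => (hg r₁ r₂).symm

namespace Rounds

/-- The state at the end of a protocol. -/
def finalState {Aout Bout A C B R A' B' C₂ : Register} (U : UnitaryOp (B × C) ((Bout × B') × C₂))
    (V : UnitaryOp (A × C₂) (Aout × A')) (v : A × C × B × R → ℂ) :
    (Aout × A') × (Bout × B') × R → ℂ :=
  fun p => ∑ q : A × C₂, V.mat p.1 q * bobStep (B₂ := Bout.tensor B') U v (q.1, q.2, p.2)

theorem output_last {Aout Bout A C B R A' B' C₂ : Register}
    (U : UnitaryOp (B × C) ((Bout × B') × C₂)) (V : UnitaryOp (A × C₂) (Aout × A'))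
    (v : A × C × B × R → ℂ) (p q : (Aout × Bout) × R) :
    (last A' B' C₂ U V).output v p q = ∑ a' : A', ∑ b' : B',
      finalState U V v ((p.1.1, a'), (p.1.2, b'), p.2)
        * star (finalState U V v ((q.1.1, a'), (q.1.2, b'), q.2)) :=
  rfl

theorem isUnitVector_finalState {Aout Bout A C B R A' B' C₂ : Register}
    (U : UnitaryOp (B × C) ((Bout × B') × C₂)) (V : UnitaryOp (A × C₂) (Aout × A'))
    {v : A × C × B × R → ℂ} (hv : IsUnitVector v) : IsUnitVector (finalState U V v) := by
  have h := V.isUnitVector_apply ((hv.bobStep (B₂ := Bout.tensor B') U).comp_equiv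
    (Equiv.prodAssoc A C₂ ((Bout × B') × R)))
  exact h

/-- Needed for parallel runs: tracing out the output and reference of one factor leaves the other
multiplied by this trace. -/
theorem trace_output {Aout Bout A C B : Register} (r : Rounds Aout Bout A C B) {R : Register}
    {v : A × C × B × R → ℂ} (hv : IsUnitVector v) : ∑ p, r.output v p p = 1 := by
  induction r with
  | last A' B' C₂ U V =>
    rw [← isUnitVector_finalState U V hv]
    simp only [output_last, ← Fintype.sum_prod_type']
    let f : ((Aout × Bout) × R) × A' × B' ≃ (Aout × A') × (Bout × B') × R :=
      ⟨fun p => ((p.1.1.1, p.2.1), (p.1.1.2, p.2.2), p.1.2),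
        fun p => (((p.1.1, p.2.1.1), p.2.2), p.1.2, p.2.1.2), fun _ => rfl, fun _ => rfl⟩
    exact Fintype.sum_equiv f _ _ fun _ => rfl
  | more B₂ C₂ A₃ C₃ U V rest ih => exact ih ((hv.bobStep U).aliceStep V)

theorem exists_messages {Aout Bout A C B : Register} (r : Rounds Aout Bout A C B) :
    ∃ k, r.messages = 2 * k + 2 := by
  induction r with
  | last => exact ⟨0, rfl⟩
  | more B₂ C₂ A₃ C₃ U V rest ih =>
    obtain ⟨k, hk⟩ := ih
    exact ⟨k + 1, by rw [messages, hk]; ring⟩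

/-- The final memory when the output register `X` is split into an output `K` and a discarded
register `D`, and there is a spectator register `E`. -/
def outputEquiv {X K D X' E : Type} (k : X ≃ K × D) : K × (D × X' × E) ≃ (X × X') × E where
  toFun p := ((k.symm (p.1, p.2.1), p.2.2.1), p.2.2.2)
  invFun p := ((k p.1.1).1, (k p.1.1).2, p.1.2, p.2)
  left_inv p := by simp
  right_inv p := by simp

/-- Alice and Bob hold the spectator registers `EA` and `EB`, and discard parts of their
output. -/
def extend {Aout Bout K D L F EA EB : Register} (kA : Aout ≃ K × D) (kB : Bout ≃ L × F) :
    {A C B A₁ B₁ : Register} → Rounds Aout Bout A C B → (A₁ ≃ A × EA) → (B₁ ≃ B × EB) →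
      Rounds K L A₁ C B₁
  | _, _, _, _, _, last A' B' C₂ U V, α, β =>
      last (D.tensor (A'.tensor EA)) (F.tensor (B'.tensor EB)) C₂
        (U.spectate (memoryEquiv β) (memoryEquiv (outputEquiv kB)))
        (V.spectate (memoryEquiv α) (outputEquiv kA))
  | _, _, _, _, _, more B₂ C₂ A₃ C₃ U V rest, α, β =>
      more (B₂.tensor EB) C₂ (A₃.tensor EA) C₃
        (U.spectate (memoryEquiv β) (memoryEquiv (Equiv.refl _)))
        (V.spectate (memoryEquiv α) (memoryEquiv (Equiv.refl _)))
        (rest.extend kA kB (Equiv.refl _) (Equiv.refl _))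

theorem messages_extend {Aout Bout K D L F EA EB : Register} (kA : Aout ≃ K × D)
    (kB : Bout ≃ L × F) {A C B A₁ B₁ : Register} (r : Rounds Aout Bout A C B)
    (α : A₁ ≃ A × EA) (β : B₁ ≃ B × EB) : (r.extend kA kB α β).messages = r.messages := by
  induction r generalizing A₁ B₁ with
  | last => rfl
  | more B₂ C₂ A₃ C₃ U V rest ih => simp only [extend, messages, ih]

theorem output_extend {Aout Bout K D L F EA EB : Register} (kA : Aout ≃ K × D)
    (kB : Bout ≃ L × F) {A C B A₁ B₁ : Register} (r : Rounds Aout Bout A C B)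
    {α : A₁ ≃ A × EA} {β : B₁ ≃ B × EB} {R R₁ : Register} {g : R₁ × EA × EB ≃ R}
    {v : A × C × B × R → ℂ} {v' : A₁ × C × B₁ × R₁ → ℂ} (h : SplitsReference α β g v v')
    (p q : (K × L) × R₁) :
    (r.extend kA kB α β).output v' p q = ∑ d : D, ∑ f : F, ∑ x : EA, ∑ y : EB,
      r.output v ((kA.symm (p.1.1, d), kB.symm (p.1.2, f)), g (p.2, x, y))
        ((kA.symm (q.1.1, d), kB.symm (q.1.2, f)), g (q.2, x, y)) := by
  induction r generalizing A₁ B₁ with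
  | @last A C B A' B' C₂ U V =>
    have key : ∀ (z : K × (D × A' × EA)) (w : L × (F × B' × EB)) (r : R₁),
        finalState (B' := F.tensor (B'.tensor EB)) (A' := D.tensor (A'.tensor EA))
          (Aout := K) (Bout := L)
          (U.spectate (memoryEquiv β) (memoryEquiv (outputEquiv kB)))
          (V.spectate (memoryEquiv α) (outputEquiv kA)) v' (z, w, r) =
        finalState U V v ((kA.symm (z.1, z.2.1), z.2.2.1), (kB.symm (w.1, w.2.1), w.2.2.1),
          g (r, z.2.2.2, w.2.2.2)) := by
      intro z w r
      have h' := h.bobStep (B₂ := Bout.tensor B') (B₃ := L.tensor (F.tensor (B'.tensor EB))) U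
        (outputEquiv kB)
      simp only [finalState]
      rw [UnitaryOp.spectate_sum]
      refine Finset.sum_congr rfl fun s _ => ?_
      rw [h' _ _ _ _]
      simp [memoryEquiv, outputEquiv]
    simp only [extend]
    rw [output_last]
    simp only [output_last, key, ← Fintype.sum_prod_type']
    let e : (D × A' × EA) × (F × B' × EB) ≃ D × F × EA × EB × A' × B' :=
      ⟨fun p => (p.1.1, p.2.1, p.1.2.2, p.2.2.2, p.1.2.1, p.2.2.1),
        fun p => ((p.1, p.2.2.2.2.1, p.2.2.1), (p.2.1, p.2.2.2.2.2, p.2.2.2.1)),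
        fun _ => rfl, fun _ => rfl⟩
    exact Fintype.sum_equiv e _ _ fun _ => rfl
  | more B₂ C₂ A₃ C₃ U V rest ih =>
    have s := h.bobStep (B₃ := B₂.tensor EB) U (Equiv.refl _)
    exact ih (s.aliceStep (A₃ := A₃.tensor EA) V (Equiv.refl _))

/-- The chain rule for the information cost: the cost is split between a protocol in which Bob
holds the part `R₂` of the reference and one in which Alice holds the part `R₁`. -/
theorem infoCost_extend_add {Aout Bout K₁ D₁ L₁ F₁ K₂ D₂ L₂ F₂ : Register}
    (kA : Aout ≃ K₁ × D₁) (kB : Bout ≃ L₁ × F₁) (kA' : Aout ≃ K₂ × D₂) (kB' : Bout ≃ L₂ × F₂)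
    {A C B A₁ B₁ A₂ B₂ : Register} (r : Rounds Aout Bout A C B) {R R₁ R₂ : Register}
    {α₁ : A₁ ≃ A × Register.one} {β₁ : B₁ ≃ B × R₂} {g₁ : R₁ × Register.one × R₂ ≃ R}
    {α₂ : A₂ ≃ A × R₁} {β₂ : B₂ ≃ B × Register.one} {g₂ : R₂ × R₁ × Register.one ≃ R}
    {v : A × C × B × R → ℂ} {v₁ : A₁ × C × B₁ × R₁ → ℂ} {v₂ : A₂ × C × B₂ × R₂ → ℂ}
    (hg : ∀ r₁ r₂, g₁ (r₁, (), r₂) = g₂ (r₂, r₁, ()))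
    (h₁ : SplitsReference α₁ β₁ g₁ v v₁) (h₂ : SplitsReference α₂ β₂ g₂ v v₂) :
    (r.extend kA kB α₁ β₁).infoCost v₁ + (r.extend kA' kB' α₂ β₂).infoCost v₂ =
      r.infoCost v := by
  induction r generalizing A₁ B₁ A₂ B₂ with
  | @last A C B A' B' C₂ U V =>
    have e₁ := h₁.infoToBob_add hg h₂
    have e₂ := (h₁.bobStep (B₂ := Bout.tensor B')
      (B₃ := L₁.tensor (F₁.tensor (B'.tensor R₂))) U (outputEquiv kB)).infoToAlice_add hg
      (h₂.bobStep (B₂ := Bout.tensor B')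
        (B₃ := L₂.tensor (F₂.tensor (B'.tensor Register.one))) U (outputEquiv kB'))
    simp only [extend, infoCost]
    linarith
  | @more A C B B' C' A' C'' U V rest ih =>
    have e₁ := h₁.infoToBob_add hg h₂
    have s₁ := h₁.bobStep (B₃ := B'.tensor _) U (Equiv.refl _)
    have s₂ := h₂.bobStep (B₃ := B'.tensor _) U (Equiv.refl _)
    have e₂ := s₁.infoToAlice_add hg s₂
    have e₃ := ih (s₁.aliceStep (A₃ := A'.tensor _) V (Equiv.refl _))
      (s₂.aliceStep (A₃ := A'.tensor _) V (Equiv.refl _))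
    simp only [extend, infoCost]
    linarith

/-- Two trivial messages can be appended. -/
theorem exists_pad {Aout Bout A C B : Register} (r : Rounds Aout Bout A C B) :
    ∃ r' : Rounds Aout Bout A C B, r'.messages = r.messages + 2 ∧
      ∀ {R : Register} (v : A × C × B × R → ℂ),
        r'.infoCost v = r.infoCost v ∧ r'.output v = r.output v := by
  induction r with
  | @last A C B A' B' C₂ U V =>
    -- Alice applies her last unitary one message earlier and keeps the result, output included, in
    -- her memory; the two further messages are one-dimensional and the remaining unitaries only
    -- relabel.
    let V' : UnitaryOp (A × C₂) ((Aout.tensor A') × Register.one) :=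
      V.spectate (X₂ := Unit) (Equiv.prodPUnit _).symm (Equiv.refl _)
    let I : UnitaryOp ((Bout.tensor B') × Register.one) ((Bout × B') × Register.one) :=
      UnitaryOp.ofEquiv (Equiv.refl _)
    let J : UnitaryOp ((Aout.tensor A') × Register.one) (Aout × A') :=
      UnitaryOp.ofEquiv (Equiv.prodPUnit _)
    refine ⟨more (Bout.tensor B') C₂ (Aout.tensor A') Register.one U V'
      (last A' B' Register.one I J), rfl, fun {R} v => ⟨?_, ?_⟩⟩
    · have : Unique (Register.one : Type) := inferInstanceAs (Unique Unit)
      simp only [infoCost, infoToAlice_eq_swapMemories, infoToBob_of_unique]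
      simp
    · have key : finalState I J (aliceStep V' (bobStep (B₂ := Bout.tensor B') U v)) =
          finalState U V v := by
        funext ⟨a, b, r⟩
        simp only [finalState, J, I]
        rw [UnitaryOp.ofEquiv_sum]
        simp only [bobStep]
        rw [UnitaryOp.ofEquiv_sum]
        simp only [aliceStep, V']
        rw [UnitaryOp.spectate_sum]
        rfl
      ext p q
      rw [output_last, ← key]
      exact output_last I J _ p q
  | more B₂ C₂ A₃ C₃ U V rest ih =>
    obtain ⟨r', h₁, h₂⟩ := ih
    refine ⟨more B₂ C₂ A₃ C₃ U V r', by rw [messages, messages, h₁], fun v => ⟨?_, ?_⟩⟩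
    · rw [infoCost, infoCost, (h₂ _).1]
    · rw [output, output, (h₂ _).2]

/-- Two protocols with the same number of messages can be run in parallel. -/
theorem exists_par {Aout₁ Bout₁ Aout₂ Bout₂ A₁ C₁ B₁ A₂ C₂ B₂ : Register}
    (r₁ : Rounds Aout₁ Bout₁ A₁ C₁ B₁) (r₂ : Rounds Aout₂ Bout₂ A₂ C₂ B₂)
    (hM : r₁.messages = r₂.messages) {A C B : Register} (α : A ≃ A₁ × A₂) (κ : C ≃ C₁ × C₂)
    (β : B ≃ B₁ × B₂) :
    ∃ r : Rounds (Aout₁.tensor Aout₂) (Bout₁.tensor Bout₂) A C B, r.messages = r₁.messages ∧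
      ∀ {R R₁ R₂ : Register} {γ : R ≃ R₁ × R₂} {v₁ : A₁ × C₁ × B₁ × R₁ → ℂ}
        {v₂ : A₂ × C₂ × B₂ × R₂ → ℂ} {v : A × C × B × R → ℂ}, IsTensor α κ β γ v₁ v₂ v →
        IsUnitVector v₁ → IsUnitVector v₂ →
        r.infoCost v = r₁.infoCost v₁ + r₂.infoCost v₂ ∧ ∀ p q, r.output v p q =
          r₁.output v₁ ((p.1.1.1, p.1.2.1), (γ p.2).1) ((q.1.1.1, q.1.2.1), (γ q.2).1)
          * r₂.output v₂ ((p.1.1.2, p.1.2.2), (γ p.2).2) ((q.1.1.2, q.1.2.2), (γ q.2).2) := by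
  have hBob : ∀ {A C B R A₁ C₁ B₁ R₁ A₂ C₂ B₂ R₂ : Register}
      {α : A ≃ A₁ × A₂} {κ : C ≃ C₁ × C₂} {β : B ≃ B₁ × B₂} {γ : R ≃ R₁ × R₂}
      {v₁ : A₁ × C₁ × B₁ × R₁ → ℂ} {v₂ : A₂ × C₂ × B₂ × R₂ → ℂ} {v : A × C × B × R → ℂ},
      IsTensor α κ β γ v₁ v₂ v → IsUnitVector v₁ → IsUnitVector v₂ →
      infoToBob v = infoToBob v₁ + infoToBob v₂ := fun h h₁ h₂ =>
    infoToBob_tensor _ _ _ _ h h₁ h₂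
  induction r₁ generalizing A₂ C₂ B₂ A C B with
  | @last A₁ C₁ B₁ A₁' B₁' C₁' U₁ V₁ =>
    cases r₂ with
    | more B₂ C₂ A₃ C₃ U V rest =>
      obtain ⟨k, hk⟩ := rest.exists_messages
      simp only [messages] at hM
      omega
    | last A₂' B₂' C₂' U₂ V₂ =>
      let e {X Y X' Y' : Type} : (X × Y) × (X' × Y') ≃ (X × X') × (Y × Y') :=
        Equiv.prodProdProdComm _ _ _ _
      refine ⟨last (A₁'.tensor A₂') (B₁'.tensor B₂') (C₁'.tensor C₂')
        (U₁.par U₂ (pairEquiv β κ) (pairEquiv e (Equiv.refl _)))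
        (V₁.par V₂ (pairEquiv α (Equiv.refl _)) e), rfl,
        fun {R R₁ R₂ γ v₁ v₂ v} h h₁ h₂ => ?_⟩
      have s := h.bobStep (B₁' := Bout₁.tensor B₁') (B₂' := Bout₂.tensor B₂')
        (B' := (Bout₁.tensor Bout₂).tensor (B₁'.tensor B₂')) (C' := C₁'.tensor C₂') U₁ U₂
        (Equiv.refl _) e
      constructor
      · have e₁ := hBob h h₁ h₂
        -- Messages to Alice: the same additivity after exchanging the memories.
        have e₂ := hBob s.swapMemories (h₁.bobStep (B₂ := Bout₁.tensor B₁') U₁).swapMemories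
          (h₂.bobStep (B₂ := Bout₂.tensor B₂') U₂).swapMemories
        simp only [← infoToAlice_eq_swapMemories] at e₂
        simp only [infoCost]
        linarith
      · have key : ∀ (a : (Aout₁ × Aout₂) × (A₁' × A₂')) (b : (Bout₁ × Bout₂) × (B₁' × B₂'))
            (r : R), finalState (Aout := Aout₁.tensor Aout₂) (Bout := Bout₁.tensor Bout₂)
              (A' := A₁'.tensor A₂') (B' := B₁'.tensor B₂') (C₂ := C₁'.tensor C₂') (U₁.par U₂ (pairEquiv β κ) (pairEquiv e (Equiv.refl _)))
              (V₁.par V₂ (pairEquiv α (Equiv.refl _)) e) v (a, b, r) =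
            finalState U₁ V₁ v₁ ((a.1.1, a.2.1), (b.1.1, b.2.1), (γ r).1)
              * finalState U₂ V₂ v₂ ((a.1.2, a.2.2), (b.1.2, b.2.2), (γ r).2) := fun a b r =>
          UnitaryOp.par_sum _ _ _ _ _ _
            (fun p : A₁ × C₁' => bobStep (B₂ := Bout₁.tensor B₁') U₁ v₁
              (p.1, p.2, (b.1.1, b.2.1), (γ r).1))
            (fun p : A₂ × C₂' => bobStep (B₂ := Bout₂.tensor B₂') U₂ v₂
              (p.1, p.2, (b.1.2, b.2.2), (γ r).2)) fun _ => s _ _ _ _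
        intro p q
        rw [output_last, output_last, output_last]
        simp only [key, ← Fintype.sum_prod_type', Finset.sum_mul_sum]
        let f : (A₁' × A₂') × (B₁' × B₂') ≃ (A₁' × B₁') × (A₂' × B₂') := e
        refine Fintype.sum_equiv f _ _ fun x => ?_
        simp only [f, e, Equiv.prodProdProdComm_apply, star_mul']
        ring
  | @more A₁ C₁ B₁ B₁' C₁' A₁' C₁'' U₁ V₁ rest₁ ih =>
    cases r₂ with
    | last A₂' B₂' C₂' U₂ V₂ =>
      obtain ⟨k, hk⟩ := rest₁.exists_messages
      simp only [messages] at hM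
      omega
    | more B₂' C₂' A₂' C₂'' U₂ V₂ rest₂ =>
      obtain ⟨r, hr, h⟩ := ih rest₂ (by simpa [messages] using hM) (A := A₁'.tensor A₂')
        (C := C₁''.tensor C₂'') (B := B₁'.tensor B₂') (Equiv.refl _) (Equiv.refl _)
        (Equiv.refl _)
      refine ⟨more (B₁'.tensor B₂') (C₁'.tensor C₂') (A₁'.tensor A₂') (C₁''.tensor C₂'')
        (U₁.par U₂ (pairEquiv β κ) (pairEquiv (Equiv.refl _) (Equiv.refl _)))
        (V₁.par V₂ (pairEquiv α (Equiv.refl _)) (pairEquiv (Equiv.refl _) (Equiv.refl _))) r,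
        by rw [messages, messages, hr], fun {R R₁ R₂ γ v₁ v₂ v} hT h₁ h₂ => ?_⟩
      have s := hT.bobStep (B' := B₁'.tensor B₂') (C' := C₁'.tensor C₂') U₁ U₂
        (Equiv.refl _) (Equiv.refl _)
      have t := s.aliceStep (A' := A₁'.tensor A₂') (C' := C₁''.tensor C₂'') V₁ V₂
        (Equiv.refl _) (Equiv.refl _)
      obtain ⟨t₁, t₂⟩ := h t ((h₁.bobStep U₁).aliceStep V₁) ((h₂.bobStep U₂).aliceStep V₂)
      refine ⟨?_, t₂⟩
      have e₁ := hBob hT h₁ h₂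
      have e₂ := hBob s.swapMemories (h₁.bobStep U₁).swapMemories (h₂.bobStep U₂).swapMemories
      simp only [← infoToAlice_eq_swapMemories] at e₂
      simp only [infoCost]
      linarith

end Rounds

/-! ### Purifications of product states -/

theorem cfc_sqrt_posSemidef {X : Type*} [Fintype X] [DecidableEq X] (ρ : Matrix X X ℂ) :
    (cfc Real.sqrt ρ).PosSemidef := by
  open scoped MatrixOrder in
  exact Matrix.nonneg_iff_posSemidef.1 (cfc_nonneg fun x _ => Real.sqrt_nonneg x)

theorem Matrix.PosSemidef.spectrum_nonneg {X : Type*} [Fintype X] [DecidableEq X]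
    {ρ : Matrix X X ℂ} (hρ : ρ.PosSemidef) : ∀ x ∈ spectrum ℝ ρ, 0 ≤ x := by
  intro x hx
  rw [hρ.isHermitian.spectrum_real_eq_range_eigenvalues] at hx
  obtain ⟨i, rfl⟩ := hx
  exact hρ.eigenvalues_nonneg i

theorem cfc_sqrt_mul_self {X : Type*} [Fintype X] [DecidableEq X] {ρ : Matrix X X ℂ}
    (hρ : ρ.PosSemidef) : cfc Real.sqrt ρ * cfc Real.sqrt ρ = ρ := by
  have hs : IsSelfAdjoint ρ := hρ.isHermitian
  rw [← cfc_mul Real.sqrt Real.sqrt ρ]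
  conv_rhs => rw [← cfc_id ℝ ρ]
  exact cfc_congr fun y hy => Real.mul_self_sqrt (hρ.spectrum_nonneg y hy)

/-- Uniqueness of the positive square root: $\sqrt{x\cdot x}=x$ on the nonnegative spectrum of `σ`.
It identifies the root of a Kronecker product without computing a spectrum. -/
theorem cfc_sqrt_eq {X : Type*} [Fintype X] [DecidableEq X] {ρ σ : Matrix X X ℂ}
    (hσ : σ.PosSemidef) (h : σ * σ = ρ) : cfc Real.sqrt ρ = σ := by
  have hs : IsSelfAdjoint σ := hσ.isHermitian
  have h1 : cfc (fun x : ℝ => x * x) σ = ρ := by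
    rw [cfc_mul (fun x : ℝ => x) (fun x : ℝ => x) σ, cfc_id' ℝ σ, h]
  rw [← h1, ← cfc_comp' Real.sqrt (fun x : ℝ => x * x) σ]
  conv_rhs => rw [← cfc_id ℝ σ]
  exact cfc_congr fun y hy => Real.sqrt_mul_self (hσ.spectrum_nonneg y hy)

/-- The standard purification of a product state is the product of the purifications. -/
theorem purification_tensor {X X₁ X₂ : Type*} [Fintype X] [DecidableEq X] [Fintype X₁]
    [DecidableEq X₁] [Fintype X₂] [DecidableEq X₂] {ρ₁ : Matrix X₁ X₁ ℂ} {ρ₂ : Matrix X₂ X₂ ℂ}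
    (h₁ : ρ₁.PosSemidef) (h₂ : ρ₂.PosSemidef) (e : X ≃ X₁ × X₂) (p : X × X) :
    purification ((ρ₁ ⊗ₖ ρ₂).submatrix e e) p =
      purification ρ₁ ((e p.1).1, (e p.2).1) * purification ρ₂ ((e p.1).2, (e p.2).2) := by
  have h := cfc_sqrt_eq
    (σ := (cfc Real.sqrt ρ₁ ⊗ₖ cfc Real.sqrt ρ₂).submatrix e e)
    (ρ := (ρ₁ ⊗ₖ ρ₂).submatrix e e)
    (((cfc_sqrt_posSemidef ρ₁).kronecker (cfc_sqrt_posSemidef ρ₂)).submatrix e) (by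
      rw [← Matrix.submatrix_mul _ _ e e e e.bijective, ← Matrix.mul_kronecker_mul,
        cfc_sqrt_mul_self h₁, cfc_sqrt_mul_self h₂])
  simp only [purification, h]
  rfl

theorem isUnitVector_purification {X : Register} (ρ : DensityOperator X) :
    IsUnitVector (purification ρ.mat) := by
  rw [IsUnitVector, Fintype.sum_prod_type, ← ρ.trace_eq_one]
  exact Finset.sum_congr rfl fun x _ => purification_spec ρ x x

/-- The input state of a product task. -/
def ProductTask.densityOperator (T : ProductTask) : DensityOperator (T.Ain.tensor T.Bin) where
  mat := T.state
  posSemidef := by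
    induction T with
    | single t => exact t.ρ.posSemidef
    | tensor T₁ T₂ h₁ h₂ => exact (h₁.kronecker h₂).submatrix _
  trace_eq_one := by
    induction T with
    | single t => exact t.ρ.trace_eq_one
    | tensor T₁ T₂ h₁ h₂ =>
      have : (T₁.state ⊗ₖ T₂.state).trace = 1 := by rw [Matrix.trace_kronecker, h₁, h₂, one_mul]
      rw [← this]
      exact Equiv.sum_comp (Equiv.prodProdProdComm T₁.Ain T₂.Ain T₁.Bin T₂.Bin)
        fun x => (T₁.state ⊗ₖ T₂.state) x x

/-! ### Every channel is implemented by a two-message protocol -/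

/-- The Kraus decomposition of a channel. -/
theorem Channel.exists_kraus {X Y : Register} (N : Channel X Y) :
    ∃ w : Y × X → Y → X → ℂ, ∀ M y y',
      N.map M y y' = ∑ k, ∑ x, ∑ x', w k y x * M x x' * star (w k y' x') := by
  have key : ∃ K : Matrix (Y × X) (Y × X) ℂ, ∀ y x y' x',
      N.map (Matrix.single x x' 1) y y' = ∑ k, star (K k (y, x)) * K k (y', x') := by
    let e := Fintype.equivFin X
    -- `ω` is the unnormalised maximally entangled vector and `h` the positivity of the Choi matrix;
    -- `Fin` serves as the reference because complete positivity is stated for it.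
    let ω : X × Fin (Fintype.card X) → ℂ := fun p => if p.1 = e.symm p.2 then 1 else 0
    have h := (N.completelyPositive _ (Matrix.vecMulVec ω (star ω))
      (Matrix.posSemidef_vecMulVec_self_star ω)).submatrix
        fun p : Y × X => (p.1, e p.2)
    -- The conjugated rows of a factor $K$ with Choi matrix $K^*K$ are the Kraus operators.
    open scoped MatrixOrder in
    obtain ⟨K, hK⟩ := CStarAlgebra.nonneg_iff_eq_star_mul_self.1 (Matrix.nonneg_iff_posSemidef.2 h)
    refine ⟨K, fun y x y' x' => ?_⟩
    have h1 := congrFun (congrFun hK (y, x)) (y', x')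
    rw [Matrix.mul_apply] at h1
    simp only [Matrix.star_apply] at h1
    rw [← h1]
    simp only [ampliation, Matrix.submatrix_apply, Matrix.of_apply]
    refine congrFun (congrFun (congrArg N.map ?_) y) y'
    ext i j
    simp [ω, Matrix.vecMulVec_apply, Matrix.single_apply, ← ite_and, eq_comm]
    simp only [and_comm]
  obtain ⟨K, hK⟩ := key
  refine ⟨fun k y x => star (K k (y, x)), fun M y y' => ?_⟩
  conv_lhs => rw [Matrix.matrix_eq_sum_single M]
  have h1 : ∀ x x', Matrix.single x x' (M x x') = M x x' • Matrix.single x x' (1 : ℂ) := by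
    intro x x'
    simp
  simp only [h1, map_sum, map_smul, Matrix.sum_apply, Matrix.smul_apply, hK, star_star,
    smul_eq_mul, Finset.mul_sum]
  symm
  rw [Finset.sum_comm]
  refine Finset.sum_congr rfl fun x _ => ?_
  rw [Finset.sum_comm]
  refine Finset.sum_congr rfl fun x' _ => Finset.sum_congr rfl fun k _ => ?_
  ring

/-- An isometry extends to a unitary. -/
theorem UnitaryOp.exists_extension {X S T : Type} [Fintype X] [DecidableEq X] [Fintype S]
    [DecidableEq S] [Fintype T] [DecidableEq T] (hc : Fintype.card S = Fintype.card T)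
    {j : X → S} (hj : Function.Injective j) {w : X → T → ℂ}
    (hw : ∀ x x', ∑ t, star (w x t) * w x' t = if x = x' then 1 else 0) :
    ∃ U : UnitaryOp S T, ∀ x t, U.mat t (j x) = w x t := by
  let u : X → EuclideanSpace ℂ T := fun x => WithLp.toLp 2 (w x)
  -- The value $0$ off the range of `j` is immaterial: the basis extension keeps only the vectors
  -- indexed by that range.
  let v : S → EuclideanSpace ℂ T := Function.extend j u 0
  have hu : Orthonormal ℂ u := by
    rw [orthonormal_iff_ite]
    intro x x'
    rw [← hw, EuclideanSpace.inner_eq_star_dotProduct]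
    exact Finset.sum_congr rfl fun t _ => mul_comm _ _
  have hv : Orthonormal ℂ ((Set.range j).domRestrict v) := by
    have h := hu.comp _ (Equiv.ofInjective j hj).symm.injective
    convert h using 1
    ext ⟨_, x, rfl⟩ : 1
    simp [v, hj.extend_apply]
  obtain ⟨b, hb⟩ := hv.exists_orthonormalBasis_extension_of_card_eq
    (by rw [finrank_euclideanSpace, hc])
  let m : Matrix T S ℂ := Matrix.of fun t s => b s t
  have hm : m.conjTranspose * m = 1 := by
    ext s s'
    have h := orthonormal_iff_ite.1 b.orthonormal s s'
    rw [EuclideanSpace.inner_eq_star_dotProduct] at h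
    rw [Matrix.one_apply, ← h, Matrix.mul_apply]
    exact Finset.sum_congr rfl fun t _ => mul_comm _ _
  refine ⟨⟨m, hm, (Matrix.mul_eq_one_comm_of_card_eq S T ℂ hc).1 hm⟩, fun x t => ?_⟩
  change b (j x) t = w x t
  rw [hb _ ⟨x, rfl⟩]
  simp [v, hj.extend_apply, u]

/-- The trace $1$ of `ρ` is preserved, while an empty output would have trace $0$. This supplies a
basis state for the ancilla of the dilation. -/
theorem Channel.nonempty_output {X Y : Register} (N : Channel X Y) (ρ : DensityOperator X) :
    Nonempty Y := by
  by_contra h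
  have : IsEmpty Y := not_nonempty_iff.1 h
  have h1 := N.tracePreserving ρ.mat
  rw [ρ.trace_eq_one] at h1
  simp [Matrix.trace] at h1

/-- Alice sends her input to Bob, who applies a dilation of the channel and sends Alice's output
back. -/
theorem Channel.exists_protocol {Ain Bin Aout Bout : Register}
    (N : Channel (Ain.tensor Bin) (Aout.tensor Bout)) (ρ : DensityOperator (Ain.tensor Bin)) :
    ∃ P : Protocol Ain Bin Aout Bout, P.messages = 2 ∧
      ∀ {R : Register} (φ : (Ain × Bin) × R → ℂ),
        P.output φ = ampliation N.map (pureState φ) := by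
  obtain ⟨w, hw⟩ := N.exists_kraus
  obtain ⟨y₀⟩ := N.nonempty_output ρ
  -- Write $X$, $Y$ for the dimensions of the joint input and output. `B'` has dimension $XY$ and
  -- carries the Kraus index; an ancilla of dimension $Y^2$ makes both sides of the unitary have
  -- dimension $XY^2$.
  let TB : Register := (Aout.tensor Bout).tensor (Aout.tensor Bout)
  let t₀ : TB := (y₀, y₀)
  let B' : Register := (Aout.tensor Bout).tensor (Ain.tensor Bin)
  have hc : Fintype.card ((Bin.tensor TB) × Ain) = Fintype.card ((Bout × B') × Aout) := by
    simp only [TB, B', Fintype.card_prod]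
    ring
  let j : Ain × Bin → (Bin.tensor TB) × Ain := fun x => ((x.2, t₀), x.1)
  have hj : Function.Injective j := by
    rintro ⟨a, b⟩ ⟨a', b'⟩ h
    simp only [j, Prod.mk.injEq] at h
    exact Prod.ext h.2 h.1.1
  obtain ⟨U, hU⟩ := UnitaryOp.exists_extension hc hj
    (w := fun x t => w t.1.2 (t.2, t.1.1) x) (by
      intro x x'
      -- Trace preservation on matrix units is exactly the isometry condition $\sum_k w_k^*w_k=1$.
      have h := N.tracePreserving (Matrix.single x' x 1)
      have h' : (Matrix.single x' x (1 : ℂ)).trace = if x = x' then 1 else 0 := by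
        by_cases hx : x = x'
        · subst hx; simp
        · rw [if_neg hx, Matrix.trace_single_eq_of_ne _ _ _ (Ne.symm hx)]
      rw [← h', ← h]
      simp only [Matrix.trace, Matrix.diag_apply, hw]
      have h2 : ∀ k y, ∑ i, ∑ i', w k y i * Matrix.single x' x (1 : ℂ) i i' * star (w k y i') =
          w k y x' * star (w k y x) := by
        intro k y
        rw [Finset.sum_eq_single x', Finset.sum_eq_single x]
        · simp
        · intro i _ hi
          simp [Matrix.single_apply_of_col_ne _ _ (Ne.symm hi)]
        · simp
        · intro i _ hi
          simp [Matrix.single_apply_of_row_ne (Ne.symm hi)]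
        · simp
      simp only [h2, ← Fintype.sum_prod_type']
      let e : (Bout × B') × Aout ≃ (Aout × Bout) × B' :=
        ⟨fun t => ((t.2, t.1.1), t.1.2), fun t => ((t.1.2, t.2), t.1.1), fun _ => rfl,
          fun _ => rfl⟩
      exact Fintype.sum_equiv e _ _ fun _ => mul_comm _ _)
  let P : Protocol Ain Bin Aout Bout :=
    { TA := Register.one
      TB := TB
      ψ := fun t => if t.2 = t₀ then 1 else 0
      ψ_unit := by
        rw [Fintype.sum_prod_type]
        simp [apply_ite]
      A₁ := Register.one
      C₁ := Ain
      U₁ := UnitaryOp.ofEquiv (Equiv.prodComm _ _)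
      rounds := Rounds.last Register.one B' Aout U (UnitaryOp.ofEquiv (Equiv.prodComm _ _)) }
  refine ⟨P, rfl, fun {R} φ => ?_⟩
  have h1 : ∀ a b t r, P.firstState φ ((), a, (b, t), r) =
      φ ((a, b), r) * if t = t₀ then 1 else 0 := by
    intro a b t r
    simp only [Protocol.firstState, P]
    rw [UnitaryOp.ofEquiv_sum]
    rfl
  have h2 : ∀ a b k r, Rounds.finalState (A' := Register.one) U
      (UnitaryOp.ofEquiv (Equiv.prodComm _ _)) (P.firstState φ) ((a, ()), (b, k), r) =
      ∑ x, w k (a, b) x * φ (x, r) := by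
    intro a b k r
    simp only [Rounds.finalState]
    rw [UnitaryOp.ofEquiv_sum]
    simp only [bobStep, Fintype.sum_prod_type, Equiv.prodComm_symm, Equiv.prodComm_apply,
      Prod.swap_prod_mk]
    have h3 : ∀ b', ∑ t, ∑ a', U.mat ((b, k), a) ((b', t), a') *
        P.firstState φ ((), a', (b', t), r) = ∑ a', w k (a, b) (a', b') * φ ((a', b'), r) := by
      intro b'
      rw [Finset.sum_comm]
      refine Finset.sum_congr rfl fun a' _ => ?_
      simp only [h1, mul_ite, mul_one, mul_zero, Finset.sum_ite_eq', Finset.mem_univ, if_true]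
      rw [← hU (a', b') ((b, k), a)]
    rw [Finset.sum_comm (s := (Finset.univ : Finset Ain))]
    exact Finset.sum_congr rfl fun b' _ => h3 b'

  ext p q
  refine (Rounds.output_last U (UnitaryOp.ofEquiv (Equiv.prodComm _ _)) (P.firstState φ) p
    q).trans ?_
  simp only [Finset.univ_unique, Finset.sum_singleton]
  simp only [ampliation, Matrix.of_apply, hw]
  refine Finset.sum_congr rfl fun k _ => ?_
  refine (congrArg₂ (fun x y => x * star y) (h2 p.1.1 p.1.2 k p.2)
    (h2 q.1.1 q.1.2 k q.2)).trans ?_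
  simp only [star_sum, Finset.sum_mul_sum]
  refine Finset.sum_congr rfl fun x _ => Finset.sum_congr rfl fun x' _ => ?_
  simp only [pureState, Matrix.vecMulVec_apply, Pi.star_apply, star_mul']
  ring

namespace Protocol

/-! ### Restricting a protocol to one factor of its input -/

/-- The initial memory when the input register `X` is split into an input `X₁` and a part `X₂`
of the shared state. -/
def inputEquiv {X X₁ X₂ T E : Type} (i : X ≃ X₁ × X₂) : X₁ × (T × (X₂ × E)) ≃ (X × T) × E where
  toFun p := ((i.symm (p.1, p.2.2.1), p.2.1), p.2.2.2)
  invFun p := ((i p.1.1).1, (p.1.2, ((i p.1.1).2, p.2)))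
  left_inv p := by simp
  right_inv p := by simp

variable {Ain Bin Aout Bout K D L F A₁ A₂ B₁ B₂ EA EB : Register}

/-- The protocol on `A₁ ⊗ B₁` that runs `P` on its input and a shared state `φ` on
`A₂ ⊗ B₂ ⊗ EA ⊗ EB`, where Alice holds `EA` and Bob holds `EB`. -/
def restrict (P : Protocol Ain Bin Aout Bout) (iA : Ain ≃ A₁ × A₂) (iB : Bin ≃ B₁ × B₂)
    (kA : Aout ≃ K × D) (kB : Bout ≃ L × F) {φ : (A₂ × B₂) × (EA × EB) → ℂ}
    (hφ : IsUnitVector φ) : Protocol A₁ B₁ K L where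
  TA := P.TA.tensor (A₂.tensor EA)
  TB := P.TB.tensor (B₂.tensor EB)
  ψ := fun t => P.ψ (t.1.1, t.2.1) * φ ((t.1.2.1, t.2.2.1), (t.1.2.2, t.2.2.2))
  ψ_unit := by
    rw [← isUnitVector_iff]
    let e : (P.TA × (A₂ × EA)) × (P.TB × (B₂ × EB)) ≃
        (P.TA × P.TB) × ((A₂ × B₂) × (EA × EB)) :=
      ⟨fun t => ((t.1.1, t.2.1), ((t.1.2.1, t.2.2.1), (t.1.2.2, t.2.2.2))),
        fun t => ((t.1.1, (t.2.1.1, t.2.2.1)), (t.1.2, (t.2.1.2, t.2.2.2))),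
        fun _ => rfl, fun _ => rfl⟩
    exact (((isUnitVector_iff _).2 P.ψ_unit).tensor hφ).comp_equiv e
  A₁ := P.A₁.tensor EA
  C₁ := P.C₁
  U₁ := P.U₁.spectate (inputEquiv iA) (memoryEquiv (Equiv.refl _))
  rounds := P.rounds.extend kA kB (Equiv.refl _) (inputEquiv iB)

theorem messages_restrict (P : Protocol Ain Bin Aout Bout) (iA : Ain ≃ A₁ × A₂)
    (iB : Bin ≃ B₁ × B₂) (kA : Aout ≃ K × D) (kB : Bout ≃ L × F)
    {φ : (A₂ × B₂) × (EA × EB) → ℂ} (hφ : IsUnitVector φ) :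
    (P.restrict iA iB kA kB hφ).messages = P.messages :=
  Rounds.messages_extend _ _ _ _ _

/-- Start of the induction over the rounds: the shared state `φ` plays the part of the second input
with its reference, so both runs give the same vector except that `EA` and `EB` move from the
reference to the parties. -/
theorem splitsReference_firstState (P : Protocol Ain Bin Aout Bout) (iA : Ain ≃ A₁ × A₂)
    (iB : Bin ≃ B₁ × B₂) (kA : Aout ≃ K × D) (kB : Bout ≃ L × F)
    {φ : (A₂ × B₂) × (EA × EB) → ℂ} (hφ : IsUnitVector φ) {R R₁ : Register}
    {g : R₁ × EA × EB ≃ R} {φ₀ : (Ain × Bin) × R → ℂ} {φ₁ : (A₁ × B₁) × R₁ → ℂ}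
    (h : ∀ a b r x y, φ₀ ((a, b), g (r, x, y)) =
      φ₁ (((iA a).1, (iB b).1), r) * φ (((iA a).2, (iB b).2), (x, y))) :
    SplitsReference (Equiv.refl (P.A₁.tensor EA)) (inputEquiv iB) g (P.firstState φ₀)
      ((P.restrict iA iB kA kB hφ).firstState φ₁) := by
  intro a c b r
  refine (UnitaryOp.spectate_sum P.U₁ (inputEquiv iA) (memoryEquiv (Equiv.refl _)) (a, c)
    _).trans ?_
  refine Finset.sum_congr rfl fun p _ => ?_
  have k := h p.1 (iB.symm (b.1, b.2.2.1)) r a.2 b.2.2.2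
  rw [Equiv.apply_symm_apply] at k
  refine Eq.trans ?_ (congrArg (fun z => P.U₁.mat (a.1, c) p * (z * P.ψ (p.2, b.2.1))) k.symm)
  simp only [restrict, memoryEquiv, inputEquiv, Equiv.trans_apply, Equiv.coe_fn_mk,
    Equiv.coe_fn_symm_mk, Equiv.prodCongr_apply, Equiv.coe_refl, Prod.map, id]
  ring

/-- A protocol on a product input is split into protocols for the factors whose information
costs add up to its cost. -/
theorem exists_split (P : Protocol (A₁.tensor A₂) (B₁.tensor B₂) (K.tensor D) (L.tensor F))
    {φ₁ : (A₁ × B₁) × (A₁ × B₁) → ℂ} {φ₂ : (A₂ × B₂) × (A₂ × B₂) → ℂ}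
    {φ : ((A₁ × A₂) × (B₁ × B₂)) × ((A₁ × A₂) × (B₁ × B₂)) → ℂ}
    (h₁ : IsUnitVector φ₁) (h₂ : IsUnitVector φ₂)
    (h : ∀ x r, φ (x, r) = φ₁ ((x.1.1, x.2.1), (r.1.1, r.2.1))
      * φ₂ ((x.1.2, x.2.2), (r.1.2, r.2.2))) :
    ∃ (P₁ : Protocol A₁ B₁ K L) (P₂ : Protocol A₂ B₂ D F),
      P₁.messages = P.messages ∧ P₂.messages = P.messages ∧
      P₁.output (R := A₁.tensor B₁) φ₁ = keepFirst (A₁ := K) (A₂ := D) (B₁ := L) (B₂ := F)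
        (P.output (R := (A₁.tensor A₂).tensor (B₁.tensor B₂)) φ) ∧
      P₂.output (R := A₂.tensor B₂) φ₂ = keepSecond (A₁ := K) (A₂ := D) (B₁ := L) (B₂ := F)
        (P.output (R := (A₁.tensor A₂).tensor (B₁.tensor B₂)) φ) ∧
      P₁.rounds.infoCost (P₁.firstState (R := A₁.tensor B₁) φ₁)
        + P₂.rounds.infoCost (P₂.firstState (R := A₂.tensor B₂) φ₂) =
      P.rounds.infoCost (P.firstState (R := (A₁.tensor A₂).tensor (B₁.tensor B₂)) φ) := by
  -- The reference of the second input goes wholly to Bob and, in `e₂`, that of the first wholly to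
  -- Alice, as the chain rules require.
  let e₁ : (A₂ × B₂) × (Register.one × (A₂.tensor B₂)) ≃ (A₂ × B₂) × (A₂ × B₂) :=
    ⟨fun p => (p.1, p.2.2), fun p => (p.1, ((), p.2)), fun _ => rfl, fun _ => rfl⟩
  let e₂ : (A₁ × B₁) × ((A₁.tensor B₁) × Register.one) ≃ (A₁ × B₁) × (A₁ × B₁) :=
    ⟨fun p => (p.1, p.2.1), fun p => (p.1, (p.2, ())), fun _ => rfl, fun _ => rfl⟩
  let g₁ : (A₁.tensor B₁) × Register.one × (A₂.tensor B₂) ≃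
      (A₁.tensor A₂).tensor (B₁.tensor B₂) :=
    ⟨fun p => ((p.1.1, p.2.2.1), (p.1.2, p.2.2.2)),
      fun p => ((p.1.1, p.2.1), ((), (p.1.2, p.2.2))), fun _ => rfl, fun _ => rfl⟩
  let g₂ : (A₂.tensor B₂) × (A₁.tensor B₁) × Register.one ≃
      (A₁.tensor A₂).tensor (B₁.tensor B₂) :=
    ⟨fun p => ((p.2.1.1, p.1.1), (p.2.1.2, p.1.2)),
      fun p => ((p.1.2, p.2.2), ((p.1.1, p.2.1), ())), fun _ => rfl, fun _ => rfl⟩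
  have u₁ := h₂.comp_equiv e₁
  have u₂ := h₁.comp_equiv e₂
  have s₁ := P.splitsReference_firstState (R₁ := A₁.tensor B₁) (g := g₁) (φ₀ := φ) (φ₁ := φ₁)
    (Equiv.refl (A₁ × A₂)) (Equiv.refl (B₁ × B₂)) (Equiv.refl (K × D)) (Equiv.refl (L × F)) u₁
    (fun _ _ _ _ _ => h _ _)
  -- `restrict` keeps the first halves, so the factors are exchanged to keep the second ones.
  have s₂ := P.splitsReference_firstState (R₁ := A₂.tensor B₂) (g := g₂) (φ₀ := φ) (φ₁ := φ₂)
    (Equiv.prodComm A₁ A₂) (Equiv.prodComm B₁ B₂) (Equiv.prodComm K D) (Equiv.prodComm L F) u₂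
    (fun _ _ _ _ _ => (h _ _).trans (mul_comm _ _))
  refine ⟨_, _, P.messages_restrict _ _ _ _ u₁, P.messages_restrict _ _ _ _ u₂, ?_, ?_,
    Rounds.infoCost_extend_add _ _ _ _ P.rounds (fun _ _ => rfl) s₁ s₂⟩
  · ext ⟨⟨a, b⟩, ⟨i, j⟩⟩ ⟨⟨a', b'⟩, ⟨i', j'⟩⟩
    refine (Rounds.output_extend _ _ P.rounds s₁ _ _).trans ?_
    simp only [keepFirst, Matrix.of_apply]
    refine Finset.sum_congr rfl fun d _ => Finset.sum_congr rfl fun f _ => ?_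
    rw [Fintype.sum_unique, Fintype.sum_prod_type]
    rfl
  · ext ⟨⟨a, b⟩, ⟨i, j⟩⟩ ⟨⟨a', b'⟩, ⟨i', j'⟩⟩
    refine (Rounds.output_extend _ _ P.rounds s₂ _ _).trans ?_
    simp only [keepSecond, Matrix.of_apply]
    refine Finset.sum_congr rfl fun d _ => Finset.sum_congr rfl fun f _ => ?_
    rw [Fintype.sum_prod_type]
    simp only [Fintype.sum_unique]
    rfl

/-! ### Running two protocols in parallel -/

theorem exists_pad_one (P : Protocol Ain Bin Aout Bout) :
    ∃ P' : Protocol Ain Bin Aout Bout, P'.messages = P.messages + 2 ∧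
      (∀ ρ, P'.infoCost ρ = P.infoCost ρ) ∧
      ∀ {R : Register} (φ : (Ain × Bin) × R → ℂ), P'.output φ = P.output φ := by
  obtain ⟨r, hr, h⟩ := P.rounds.exists_pad
  exact ⟨{ P with rounds := r }, hr, fun ρ => (h _).1, fun φ => (h _).2⟩

theorem exists_pad (P : Protocol Ain Bin Aout Bout) (n : ℕ) :
    ∃ P' : Protocol Ain Bin Aout Bout, P'.messages = P.messages + 2 * n ∧
      (∀ ρ, P'.infoCost ρ = P.infoCost ρ) ∧
      ∀ {R : Register} (φ : (Ain × Bin) × R → ℂ), P'.output φ = P.output φ := by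
  induction n with
  | zero => exact ⟨P, rfl, fun _ => rfl, fun _ => rfl⟩
  | succ n ih =>
    obtain ⟨P₁, h₁, h₂, h₃⟩ := ih
    obtain ⟨P₂, k₁, k₂, k₃⟩ := P₁.exists_pad_one
    exact ⟨P₂, by rw [k₁, h₁]; ring, fun ρ => (k₂ ρ).trans (h₂ ρ),
      fun φ => (k₃ φ).trans (h₃ φ)⟩

theorem isUnitVector_firstState (P : Protocol Ain Bin Aout Bout) {R : Register}
    {φ : (Ain × Bin) × R → ℂ} (hφ : IsUnitVector φ) : IsUnitVector (P.firstState φ) := by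
  let e : (Ain × P.TA) × (Bin.tensor P.TB × R) ≃ ((Ain × Bin) × R) × (P.TA × P.TB) :=
    ⟨fun t => (((t.1.1, t.2.1.1), t.2.2), (t.1.2, t.2.1.2)),
      fun t => ((t.1.1.1, t.2.1), ((t.1.1.2, t.2.2), t.1.2)), fun _ => rfl, fun _ => rfl⟩
  have h := P.U₁.isUnitVector_apply
    ((hφ.tensor ((isUnitVector_iff _).2 P.ψ_unit)).comp_equiv e)
  exact h.comp_equiv (Equiv.prodAssoc P.A₁ P.C₁ (Bin.tensor P.TB × R)).symm

/-- Two protocols with the same number of messages can be run in parallel, and their costs add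
up. -/
theorem exists_par (P₁ : Protocol A₁ B₁ K L) (P₂ : Protocol A₂ B₂ D F)
    (hM : P₁.messages = P₂.messages)
    {φ₁ : (A₁ × B₁) × (A₁ × B₁) → ℂ} {φ₂ : (A₂ × B₂) × (A₂ × B₂) → ℂ}
    {φ : ((A₁ × A₂) × (B₁ × B₂)) × ((A₁ × A₂) × (B₁ × B₂)) → ℂ}
    (h₁ : IsUnitVector φ₁) (h₂ : IsUnitVector φ₂)
    (h : ∀ x r, φ (x, r) = φ₁ ((x.1.1, x.2.1), (r.1.1, r.2.1))
      * φ₂ ((x.1.2, x.2.2), (r.1.2, r.2.2))) :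
    ∃ P : Protocol (A₁.tensor A₂) (B₁.tensor B₂) (K.tensor D) (L.tensor F),
      P.messages = P₁.messages ∧
      keepFirst (A₁ := K) (A₂ := D) (B₁ := L) (B₂ := F)
        (P.output (R := (A₁.tensor A₂).tensor (B₁.tensor B₂)) φ) =
        P₁.output (R := A₁.tensor B₁) φ₁ ∧
      keepSecond (A₁ := K) (A₂ := D) (B₁ := L) (B₂ := F)
        (P.output (R := (A₁.tensor A₂).tensor (B₁.tensor B₂)) φ) =
        P₂.output (R := A₂.tensor B₂) φ₂ ∧
      P.rounds.infoCost (P.firstState (R := (A₁.tensor A₂).tensor (B₁.tensor B₂)) φ) =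
      P₁.rounds.infoCost (P₁.firstState (R := A₁.tensor B₁) φ₁)
        + P₂.rounds.infoCost (P₂.firstState (R := A₂.tensor B₂) φ₂) := by
  let e {X Y X' Y' : Type} : (X × Y) × (X' × Y') ≃ (X × X') × (Y × Y') :=
    Equiv.prodProdProdComm _ _ _ _
  obtain ⟨r, hr, hcost⟩ := P₁.rounds.exists_par P₂.rounds hM
    (A := P₁.A₁.tensor P₂.A₁) (C := P₁.C₁.tensor P₂.C₁)
    (B := (B₁.tensor B₂).tensor (P₁.TB.tensor P₂.TB)) (Equiv.refl _) (Equiv.refl _) e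
  let P : Protocol (A₁.tensor A₂) (B₁.tensor B₂) (K.tensor D) (L.tensor F) :=
    { TA := P₁.TA.tensor P₂.TA
      TB := P₁.TB.tensor P₂.TB
      ψ := fun t => P₁.ψ (t.1.1, t.2.1) * P₂.ψ (t.1.2, t.2.2)
      ψ_unit := by
        rw [← isUnitVector_iff]
        let e' : (P₁.TA × P₂.TA) × (P₁.TB × P₂.TB) ≃ (P₁.TA × P₁.TB) × (P₂.TA × P₂.TB) := e
        exact (((isUnitVector_iff _).2 P₁.ψ_unit).tensor
          ((isUnitVector_iff _).2 P₂.ψ_unit)).comp_equiv e'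
      A₁ := P₁.A₁.tensor P₂.A₁
      C₁ := P₁.C₁.tensor P₂.C₁
      U₁ := P₁.U₁.par P₂.U₁ e e
      rounds := r }
  let γ : (A₁.tensor A₂).tensor (B₁.tensor B₂) ≃ (A₁.tensor B₁) × (A₂.tensor B₂) := e
  have hT : IsTensor (Equiv.refl _) (Equiv.refl _) e γ
      (P₁.firstState (R := A₁.tensor B₁) φ₁) (P₂.firstState (R := A₂.tensor B₂) φ₂)
      (P.firstState (R := (A₁.tensor A₂).tensor (B₁.tensor B₂)) φ) := by
    intro a c b s
    refine UnitaryOp.par_sum P₁.U₁ P₂.U₁ e e (a, c) _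
      (fun p => φ₁ ((p.1, b.1.1), (s.1.1, s.2.1)) * P₁.ψ (p.2, b.2.1))
      (fun p => φ₂ ((p.1, b.1.2), (s.1.2, s.2.2)) * P₂.ψ (p.2, b.2.2)) fun x => ?_
    simp only [h, P, e, Equiv.prodProdProdComm_apply]
    ring
  have n₁ := P₁.isUnitVector_firstState (R := A₁.tensor B₁) h₁
  have n₂ := P₂.isUnitVector_firstState (R := A₂.tensor B₂) h₂
  obtain ⟨c, o⟩ := hcost hT n₁ n₂
  refine ⟨P, hr, ?_, ?_, c⟩
  · have t := P₂.rounds.trace_output n₂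
    ext ⟨⟨a, b⟩, ⟨i, j⟩⟩ ⟨⟨a', b'⟩, ⟨i', j'⟩⟩
    simp only [keepFirst, Matrix.of_apply]
    refine Eq.trans (b := ∑ x : D, ∑ y : F, ∑ k : A₂, ∑ l : B₂,
      P₁.output (R := A₁.tensor B₁) φ₁ ((a, b), (i, j)) ((a', b'), (i', j')) *
        P₂.output (R := A₂.tensor B₂) φ₂ ((x, y), (k, l)) ((x, y), (k, l))) ?_ ?_
    · exact Finset.sum_congr rfl fun _ _ => Finset.sum_congr rfl fun _ _ =>
        Finset.sum_congr rfl fun _ _ => Finset.sum_congr rfl fun _ _ => o _ _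
    · simp only [← Finset.mul_sum]
      simp only [Fintype.sum_prod_type] at t
      exact (congrArg _ t).trans (mul_one _)
  · have t := P₁.rounds.trace_output n₁
    ext ⟨⟨a, b⟩, ⟨i, j⟩⟩ ⟨⟨a', b'⟩, ⟨i', j'⟩⟩
    simp only [keepSecond, Matrix.of_apply]
    refine Eq.trans (b := ∑ x : K, ∑ y : L, ∑ k : A₁, ∑ l : B₁,
      P₁.output (R := A₁.tensor B₁) φ₁ ((x, y), (k, l)) ((x, y), (k, l)) *
        P₂.output (R := A₂.tensor B₂) φ₂ ((a, b), (i, j)) ((a', b'), (i', j'))) ?_ ?_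
    · exact Finset.sum_congr rfl fun _ _ => Finset.sum_congr rfl fun _ _ =>
        Finset.sum_congr rfl fun _ _ => Finset.sum_congr rfl fun _ _ => o _ _
    · simp only [← Finset.sum_mul]
      simp only [Fintype.sum_prod_type] at t
      exact (congrArg (· * _) t).trans (one_mul _)

end Protocol

/-! ### Additivity -/

theorem traceNorm_zero {X : Type*} [Fintype X] [DecidableEq X] :
    traceNorm (0 : Matrix X X ℂ) = 0 := by
  simp [traceNorm, Multiset.map_nsmul, Multiset.sum_nsmul]

/-- `split` gives one inequality and `join` the other. Since `f₁` and `f₂` may be unbounded below,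
`hne` is what excludes $\top+\bot=\bot$ on the right against $\top$ on the left. -/
theorem iInf_eq_add_iInf {ι ι₁ ι₂ : Type*} {f : ι → ℝ} {f₁ : ι₁ → ℝ} {f₂ : ι₂ → ℝ}
    {p : ι → Prop} {p₁ : ι₁ → Prop} {p₂ : ι₂ → Prop} (hne : (∃ i, p₁ i) ↔ ∃ i, p₂ i)
    (split : ∀ i, p i → ∃ i₁ i₂, p₁ i₁ ∧ p₂ i₂ ∧ f₁ i₁ + f₂ i₂ = f i)
    (join : ∀ i₁ i₂, p₁ i₁ → p₂ i₂ → ∃ i, p i ∧ f i = f₁ i₁ + f₂ i₂) :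
    (⨅ (i) (_ : p i), (f i : EReal)) =
      (⨅ (i) (_ : p₁ i), (f₁ i : EReal)) + ⨅ (i) (_ : p₂ i), (f₂ i : EReal) := by
  apply le_antisymm
  · by_cases h : ∃ i, p₁ i
    · have h₁ : (⨅ (i) (_ : p₁ i), (f₁ i : EReal)) ≠ ⊤ := by
        obtain ⟨i, hi⟩ := h
        exact ((iInf₂_le i hi).trans_lt (EReal.coe_lt_top _)).ne
      have h₂ : (⨅ (i) (_ : p₂ i), (f₂ i : EReal)) ≠ ⊤ := by
        obtain ⟨i, hi⟩ := hne.1 h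
        exact ((iInf₂_le i hi).trans_lt (EReal.coe_lt_top _)).ne
      refine EReal.le_add_of_forall_gt (.inr h₂) (.inl h₁) fun a ha b hb => ?_
      simp only [gt_iff_lt, iInf_lt_iff] at ha hb
      obtain ⟨i₁, hi₁, ha⟩ := ha
      obtain ⟨i₂, hi₂, hb⟩ := hb
      obtain ⟨i, hi, hf⟩ := join i₁ i₂ hi₁ hi₂
      refine (iInf₂_le i hi).trans ?_
      rw [hf, EReal.coe_add]
      exact add_le_add ha.le hb.le
    -- Neither factor is feasible: the right-hand side is $\top+\top=\top$.
    · have h₂ : ¬ ∃ i, p₂ i := fun h' => h (hne.2 h')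
      push Not at h h₂
      simp [h, h₂]
  · refine le_iInf₂ fun i hi => ?_
    obtain ⟨i₁, i₂, h₁, h₂, hf⟩ := split i hi
    rw [← hf, EReal.coe_add]
    exact add_le_add (iInf₂_le i₁ h₁) (iInf₂_le i₂ h₂)

/-! ### Splitting, joining and padding protocols for product tasks -/

namespace ProductTask

theorem purification_state_tensor (T₁ T₂ : ProductTask)
    (x r : (T₁.Ain × T₂.Ain) × (T₁.Bin × T₂.Bin)) :
    purification (T₁.tensor T₂).state (x, r) =
      purification T₁.state ((x.1.1, x.2.1), (r.1.1, r.2.1))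
        * purification T₂.state ((x.1.2, x.2.2), (r.1.2, r.2.2)) :=
  purification_tensor T₁.densityOperator.posSemidef T₂.densityOperator.posSemidef
    (Equiv.prodProdProdComm T₁.Ain T₂.Ain T₁.Bin T₂.Bin) (x, r)

/-- Success is judged on the marginal of each component, so it passes to the two protocols with the
same errors. -/
theorem exists_split {T₁ T₂ : ProductTask} (P : Protocol (T₁.tensor T₂).Ain (T₁.tensor T₂).Bin
    (T₁.tensor T₂).Aout (T₁.tensor T₂).Bout) (h : (T₁.tensor T₂).Succeeds P) :
    ∃ (P₁ : Protocol T₁.Ain T₁.Bin T₁.Aout T₁.Bout)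
      (P₂ : Protocol T₂.Ain T₂.Bin T₂.Aout T₂.Bout),
      (T₁.Succeeds P₁ ∧ P₁.messages = P.messages) ∧ (T₂.Succeeds P₂ ∧ P₂.messages = P.messages) ∧
      P₁.infoCost T₁.state + P₂.infoCost T₂.state = P.infoCost (T₁.tensor T₂).state := by
  obtain ⟨P₁, P₂, m₁, m₂, o₁, o₂, c⟩ := Protocol.exists_split
    (A₁ := T₁.Ain) (A₂ := T₂.Ain) (B₁ := T₁.Bin) (B₂ := T₂.Bin)
    (K := T₁.Aout) (D := T₂.Aout) (L := T₁.Bout) (F := T₂.Bout) P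
    (isUnitVector_purification T₁.densityOperator) (isUnitVector_purification T₂.densityOperator)
    (purification_state_tensor T₁ T₂)
  refine ⟨P₁, P₂, ⟨?_, m₁⟩, ⟨?_, m₂⟩, c⟩
  · exact (congrArg T₁.IsClose o₁).mpr h.1
  · exact (congrArg T₂.IsClose o₂).mpr h.2

theorem exists_join {T₁ T₂ : ProductTask} (P₁ : Protocol T₁.Ain T₁.Bin T₁.Aout T₁.Bout)
    (P₂ : Protocol T₂.Ain T₂.Bin T₂.Aout T₂.Bout) (h₁ : T₁.Succeeds P₁) (h₂ : T₂.Succeeds P₂)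
    (hM : P₁.messages = P₂.messages) :
    ∃ P : Protocol (T₁.tensor T₂).Ain (T₁.tensor T₂).Bin (T₁.tensor T₂).Aout
        (T₁.tensor T₂).Bout,
      ((T₁.tensor T₂).Succeeds P ∧ P.messages = P₁.messages) ∧
      P.infoCost (T₁.tensor T₂).state = P₁.infoCost T₁.state + P₂.infoCost T₂.state := by
  obtain ⟨P, m, o₁, o₂, c⟩ := P₁.exists_par P₂ hM
    (isUnitVector_purification T₁.densityOperator) (isUnitVector_purification T₂.densityOperator)
    (purification_state_tensor T₁ T₂)
  exact ⟨P, ⟨⟨(congrArg T₁.IsClose o₁).mpr h₁, (congrArg T₂.IsClose o₂).mpr h₂⟩, m⟩, c⟩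

theorem exists_pad {T : ProductTask} (P : Protocol T.Ain T.Bin T.Aout T.Bout)
    (h : T.Succeeds P) (n : ℕ) :
    ∃ P' : Protocol T.Ain T.Bin T.Aout T.Bout, T.Succeeds P' ∧
      P'.messages = P.messages + 2 * n ∧ P'.infoCost T.state = P.infoCost T.state := by
  obtain ⟨P', h₁, h₂, h₃⟩ := P.exists_pad n
  exact ⟨P', (congrArg T.IsClose (h₃ _)).mpr h, h₁, h₂ _⟩

/-- Every product task can be solved with any even, positive number of messages. -/
theorem exists_succeeds (T : ProductTask) (k : ℕ) :
    ∃ P : Protocol T.Ain T.Bin T.Aout T.Bout, T.Succeeds P ∧ P.messages = 2 * k + 2 := by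
  induction T with
  | single t =>
    obtain ⟨P, hP, ho⟩ := t.N.exists_protocol t.ρ
    have h : (single t).Succeeds P := by
      change traceNorm (P.output (R := t.Ain.tensor t.Bin) (purification t.ρ.mat) - _) ≤ t.ε
      rw [ho, sub_self, traceNorm_zero]
      exact t.ε_mem.1
    obtain ⟨P', h₁, h₂, -⟩ := exists_pad (T := single t) P h k
    exact ⟨P', h₁, h₂.trans ((congrArg (· + 2 * k) hP).trans (add_comm _ _))⟩
  | tensor T₁ T₂ ih₁ ih₂ =>
    obtain ⟨P₁, h₁, m₁⟩ := ih₁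
    obtain ⟨P₂, h₂, m₂⟩ := ih₂
    obtain ⟨P, ⟨h, m⟩, -⟩ := exists_join P₁ P₂ h₁ h₂ (m₁.trans m₂.symm)
    exact ⟨P, h, m.trans m₁⟩

/-- The number of messages is always even and positive, and every such number suffices for every
task. Feasibility thus depends on `M` alone, which is the hypothesis `hne` of `iInf_eq_add_iInf`. -/
theorem exists_succeeds_messages {T : ProductTask} (T' : ProductTask) {M : ℕ}
    (h : ∃ P : Protocol T.Ain T.Bin T.Aout T.Bout, T.Succeeds P ∧ P.messages = M) :
    ∃ P : Protocol T'.Ain T'.Bin T'.Aout T'.Bout, T'.Succeeds P ∧ P.messages = M := by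
  obtain ⟨P, -, hM⟩ := h
  obtain ⟨k, hk⟩ := P.rounds.exists_messages
  obtain ⟨P', h', hM'⟩ := T'.exists_succeeds k
  exact ⟨P', h', hM'.trans (hk.symm.trans hM)⟩

theorem QICM_tensor (T₁ T₂ : ProductTask) (M : ℕ) :
    (T₁.tensor T₂).QICM M = T₁.QICM M + T₂.QICM M := by
  refine iInf_eq_add_iInf ⟨exists_succeeds_messages T₂, exists_succeeds_messages T₁⟩ ?_ ?_
  · rintro P ⟨h, hM⟩
    obtain ⟨P₁, P₂, ⟨h₁, m₁⟩, ⟨h₂, m₂⟩, c⟩ := exists_split P h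
    exact ⟨P₁, P₂, ⟨h₁, m₁.trans hM⟩, ⟨h₂, m₂.trans hM⟩, c⟩
  · rintro P₁ P₂ ⟨h₁, m₁⟩ ⟨h₂, m₂⟩
    obtain ⟨P, ⟨h, m⟩, c⟩ := exists_join P₁ P₂ h₁ h₂ (m₁.trans m₂.symm)
    exact ⟨P, ⟨h, m.trans m₁⟩, c⟩

theorem QIC_tensor (T₁ T₂ : ProductTask) : (T₁.tensor T₂).QIC = T₁.QIC + T₂.QIC := by
  have hne : ∀ T : ProductTask, ∃ P, T.Succeeds P := fun T =>
    (T.exists_succeeds 0).imp fun _ h => h.1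
  refine iInf_eq_add_iInf ⟨fun _ => hne T₂, fun _ => hne T₁⟩ ?_ ?_
  · intro P h
    obtain ⟨P₁, P₂, ⟨h₁, -⟩, ⟨h₂, -⟩, c⟩ := exists_split P h
    exact ⟨P₁, P₂, h₁, h₂, c⟩
  · intro P₁ P₂ h₁ h₂
    obtain ⟨k₁, m₁⟩ := P₁.rounds.exists_messages
    obtain ⟨k₂, m₂⟩ := P₂.rounds.exists_messages
    -- Each protocol is padded by the round count of the other, so both reach $2(k_1+k_2)+2$
    -- messages.
    obtain ⟨P₁', h₁', m₁', c₁⟩ := exists_pad P₁ h₁ k₂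
    obtain ⟨P₂', h₂', m₂', c₂⟩ := exists_pad P₂ h₂ k₁
    obtain ⟨P, ⟨h, -⟩, c⟩ := exists_join P₁' P₂' h₁' h₂' (by
      rw [m₁', m₂', Protocol.messages, Protocol.messages, m₁, m₂]
      ring)
    exact ⟨P, h, by rw [c, c₁, c₂]⟩

end ProductTask

/-- Induction on the number of factors. Distributivity in `EReal` is safe because the multipliers
are nonnegative, whatever the value of `F`, infinite ones included. -/
theorem QTask.mul_eq_nFold {t : QTask} {F : ProductTask → EReal}
    (hF : ∀ T₁ T₂ : ProductTask, F (T₁.tensor T₂) = F T₁ + F T₂) (n : ℕ) :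
    ((n + 1 : ℕ) : EReal) * F (.single t) = F (t.nFold (n + 1)) := by
  induction n with
  | zero => simp [nFold]
  | succ n ih =>
    rw [nFold, hF, ← ih, Nat.cast_succ,
      EReal.right_distrib_of_nonneg (by exact_mod_cast Nat.zero_le _) zero_le_one, one_mul]

theorem mainTheorem5 :
    (∀ T₁ T₂ : ProductTask,
      (T₁.tensor T₂).QIC = T₁.QIC + T₂.QIC ∧
      ∀ M : ℕ, (T₁.tensor T₂).QICM M = T₁.QICM M + T₂.QICM M) ∧
    (∀ (t : QTask) (n : ℕ), 1 ≤ n →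
      (n : EReal) * t.QIC = t.nFoldQIC n ∧
      ∀ M : ℕ, (n : EReal) * t.QICM M = t.nFoldQICM n M) := by
  refine ⟨fun T₁ T₂ => ⟨ProductTask.QIC_tensor T₁ T₂, ProductTask.QICM_tensor T₁ T₂⟩,
    fun t n hn => ?_⟩
  obtain ⟨n, rfl⟩ := Nat.exists_eq_add_of_le' hn
  -- The complexities of a single task agree by definition with those of the product task `.single
  -- t`.
  exact ⟨QTask.mul_eq_nFold ProductTask.QIC_tensor n,
    fun M => QTask.mul_eq_nFold (F := fun T => T.QICM M)
      (fun T₁ T₂ => ProductTask.QICM_tensor T₁ T₂ M) n⟩
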